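/- Let $C$ be a compact connected Riemann surface of genus $g\ge 2$ with a projective coordinate system: a cover by coordinate neighbourhoods $(U_\alpha,z_\alpha)$ with $z_\alpha=\frac{a_{\alpha\beta}z_\beta+b_{\alpha\beta}}{c_{\alpha\beta}z_\beta+d_{\alpha\beta}}$ on $U_\alpha\cap U_\beta$, where the matrices $f_{\alpha\beta}=\begin{bmatrix}a_{\alpha\beta}&b_{\alpha\beta}\\c_{\alpha\beta}&d_{\alpha\beta}\end{bmatrix}\in SL_2(\mathbb C)$ form a cocycle. Let $K^{1/2}$ be the theta characteristic with transition functions $\xi_{\alpha\beta}=c_{\alpha\beta}z_\beta+d_{\alpha\beta}$, let $q\in H^0(C,K^{2})$ be a holomorphic quadratic differential, $q=q_\alpha\,dz_\alpha^2$ on $U_\alpha$, and put $\phi_\alpha(q)=\begin{bmatrix}0&q_\alpha\\1&0\end{bmatrix}$. For $\hbar\in\mathbb C$ let $E_\hbar$ be the rank $2$ bundle with transition functions $\begin{bmatrix}\xi_{\alpha\beta}&-\hbar\,\partial_{z_\beta}\xi_{\alpha\beta}\\0&\xi_{\alpha\beta}^{-1}\end{bmatrix}$ (sections satisfy $\Psi_\alpha=g^\hbar_{\alpha\beta}\Psi_\beta$),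 an extension of $K^{-1/2}$ by $K^{1/2}$ with $E_0=K^{1/2}\oplus K^{-1/2}$. Let $\hbar\nabla^\hbar(q):E_\hbar\to E_\hbar\otimes K$ be the $\hbar$-connection given by $\hbar d-\phi_\alpha(q)\,dz_\alpha$ on $U_\alpha$, and let $\phi(q):E_0\to E_0\otimes K$ be the Higgs field given by $\phi_\alpha(q)\,dz_\alpha$. Let $\partial=d/dz_\alpha$ on $U_\alpha$. Then: 1. The formula $\hbar d-\phi_\alpha(q)dz_\alpha$ holds in the frame of $E_\hbar$ over every $U_\alpha$, for one and the same global operator $\hbar\nabla^\hbar(q)$. 2. (Quantum curve.) Let $\hbar\neq0$. (a) For every $\alpha$ and every open $U\subset U_\alpha$ there is exactly one structure of module over the ring $\mathcal D(U)=\mathcal O(U)\langle\partial\rangle$ of holomorphic differential operators on the space $E_\hbar(U)$ of holomorphic sections for which functions act by multiplication and $\hbar\partial$ acts as $\hbar\nabla^\hbar(q)$ contracted with $\partial/\partial z_\alpha$. With this structure $E_\hbar(U)\cong\mathcal D(U)/\mathcal D(U)\,(\hbar^2\partial^2-q_\alpha)$, where $1$ corresponds to the local frame $(1,0)$ of the subbundle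 $K^{1/2}$. (b) For every open $U\subset C$, the projection $E_\hbar\to K^{-1/2}$ maps the flat sections of $\hbar\nabla^\hbar(q)$ over $U$ bijectively onto the sections $\psi$ of $K^{-1/2}$ over $U$ that satisfy $\hbar^2\psi''-q\psi=0$ in every projective coordinate $z_\alpha$; the flat section corresponding to $\psi$ is $(\hbar\psi',\psi)$ in the frame over $U_\alpha$. (c) For any $\hbar\in\mathbb C$, the operator $\hbar^2\partial^2-q$ is globally defined from $K^{-1/2}$ to $K^{3/2}$: for a local section $\psi$ of $K^{-1/2}$, the functions $\hbar^2\psi_\alpha''-q_\alpha\psi_\alpha$ transform by $\xi_{\alpha\beta}^3$. 3. (Semi-classical limit.) Define the semi-classical limit of the family $(E_\hbar,\hbar\nabla^\hbar(q))_\hbar$ as the set of all $(x,\eta)\in T^*C$ at which $\det\sigma=0$, where $\sigma=\lim_{\hbar\to0}e^{-S_0/\hbar}\circ\hbar\nabla^\hbar(q)\circ e^{S_0/\hbar}$ at $x$ (the limit being taken in the local frames, for every holomorphic function $S_0$ near $x$ with $dS_0(x)=\eta$). Then this limit exists at every $(x,\eta)$ and equals $\eta-\phi(q)$, acting on $E_0$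 with values in $E_0\otimes K$. Hence the semi-classical limit is the Hitchin spectral curve $\Sigma=\{\det(\eta-\phi(q))=0\}\subset T^*C$. Moreover $\det(\eta-\phi(q))=\eta^2-q$, so that $\Sigma$ is $y^2-q_\alpha=0$ over $U_\alpha$, where $\eta=y\,dz_\alpha$. Likewise, for all holomorphic functions $S_0$, $u$ near $x\in U_\alpha$, $$\lim_{\hbar\to0}e^{-S_0/\hbar}\left[\hbar^2\left(\tfrac{d}{dz_\alpha}\right)^2-q_\alpha\right]\left(e^{S_0/\hbar}u\right)(x)=(y^2-q_\alpha)\,u(x),\qquad dS_0(x)=y\,dz_\alpha .$$ -/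

import Mathlib

open scoped Manifold ContDiff Topology MatrixGroups
open TopologicalSpace

set_option linter.unusedSectionVars false

noncomputable section

namespace OperSCL

/-! ### Coordinate vectors, forms and differentials on a Riemann surface -/

section Surface

variable {C : Type*} [TopologicalSpace C] [ChartedSpace ℂ C]

/-- The coordinate vector `∂/∂z` at `x`, for a local coordinate `z = e`. -/
def coordVec (e : OpenPartialHomeomorph C ℂ) (x : C) : TangentSpace 𝓘(ℂ, ℂ) x :=
  (mfderiv 𝓘(ℂ, ℂ) 𝓘(ℂ, ℂ) e.symm (e x) : ℂ →L[ℂ] ℂ) (1 : ℂ)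

/-- The derivative `df/dz` of a function `f`, for a local coordinate `z = e`. -/
def dz (e : OpenPartialHomeomorph C ℂ) (f : C → ℂ) (x : C) : ℂ :=
  (mfderiv 𝓘(ℂ, ℂ) 𝓘(ℂ, ℂ) f x : ℂ →L[ℂ] ℂ) (coordVec e x)

variable (C) in
/-- `H⁰(C, K)`: holomorphic one-forms, i.e. those `ω` with `ω = w(z) dz`, `w` holomorphic,
in every holomorphic local coordinate `z`. -/
def oneForms : Submodule ℂ ((x : C) → TangentSpace 𝓘(ℂ, ℂ) x →L[ℂ] ℂ) where
  carrier := {w | ∀ e ∈ IsManifold.maximalAtlas 𝓘(ℂ, ℂ) ω C,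
    ContMDiffOn 𝓘(ℂ, ℂ) 𝓘(ℂ, ℂ) ω (fun x => w x (coordVec e x)) e.source}
  add_mem' ha hb e he := (ha e he).add (hb e he)
  zero_mem' _ _ := contMDiffOn_const
  smul_mem' a _ hb e he := (contMDiffOn_const (c := a)).mul (hb e he)

variable (C) in
/-- The genus of a compact Riemann surface: the dimension of `H⁰(C, K)`. -/
def genus : ℕ := Module.finrank ℂ (oneForms C)

variable (C) in
/-- `H⁰(C, K²)`: holomorphic quadratic differentials, i.e. bilinear forms on the tangent
lines that are `q(z) dz²`, `q(z)` holomorphic, in every holomorphic local coordinate `z`. -/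
def quadraticDifferentials :
    Submodule ℂ ((x : C) → TangentSpace 𝓘(ℂ, ℂ) x →L[ℂ] TangentSpace 𝓘(ℂ, ℂ) x →L[ℂ] ℂ) where
  carrier := {q | ∀ e ∈ IsManifold.maximalAtlas 𝓘(ℂ, ℂ) ω C,
    ContMDiffOn 𝓘(ℂ, ℂ) 𝓘(ℂ, ℂ) ω (fun x => q x (coordVec e x) (coordVec e x)) e.source}
  add_mem' ha hb e he := (ha e he).add (hb e he)
  zero_mem' _ _ := contMDiffOn_const
  smul_mem' a _ hb e he := (contMDiffOn_const (c := a)).mul (hb e he)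

/-- The coefficient `q(z)` of `q = q(z) dz²` in the local coordinate `z = e`. -/
def coeff (q : quadraticDifferentials C) (e : OpenPartialHomeomorph C ℂ) (x : C) : ℂ :=
  q.1 x (coordVec e x) (coordVec e x)

variable (C) in
/-- The total space of the cotangent bundle `T*C`. -/
abbrev Cotangent : Type _ :=
  Bundle.TotalSpace (ℂ →L[ℂ] ℂ) (fun x : C => TangentSpace 𝓘(ℂ, ℂ) x →L[ℂ] ℂ)

/-- The ring `O(U)` of holomorphic functions on an open set `U`. -/
abbrev Hol (U : Opens C) : Type _ := C^ω⟮𝓘(ℂ, ℂ), U; 𝓘(ℂ, ℂ), ℂ⟯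

open Classical in
/-- Extension by zero of a family of vectors over an open set (only its values on the open set
will matter). -/
def ext0 {V : C → Type*} [∀ x, Zero (V x)] {U : Opens C} (s : (x : U) → V x) (x : C) : V x :=
  if h : x ∈ U then s ⟨x, h⟩ else 0

end Surface

/-! ### Holomorphic sections of a bundle given by transition functions -/

section Sections

variable {C ι F : Type*} [TopologicalSpace C] [ChartedSpace ℂ C]
  [NormedAddCommGroup F] [NormedSpace ℂ F] (Z : VectorBundleCore ℂ C F ι)

/-- The expression `s_α` of a section `s` in the local frame over `U_α`. -/
def comp (α : ι) (s : (x : C) → Z.Fiber x) (x : C) : F :=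
  Z.coordChange (Z.indexAt x) α x (s x)

/-- The section whose expression in the local frame over `U_α` is `u`. -/
def ofComp (α : ι) (u : C → F) (x : C) : Z.Fiber x :=
  (Z.coordChange α (Z.indexAt x) x (u x) : F)

theorem ext0_add {U : Opens C} (s t : (x : U) → Z.Fiber x) :
    ext0 (s + t) = ext0 s + ext0 t := by
  funext x
  by_cases h : x ∈ U <;> simp [ext0, h]

theorem ext0_smul {U : Opens C} (a : ℂ) (s : (x : U) → Z.Fiber x) :
    ext0 (a • s) = a • ext0 s := by
  funext x
  by_cases h : x ∈ U <;> simp [ext0, h]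

theorem comp_add (α : ι) (s t : (x : C) → Z.Fiber x) :
    comp Z α (s + t) = comp Z α s + comp Z α t := by
  funext x
  exact (Z.coordChange (Z.indexAt x) α x).map_add _ _

theorem comp_smul (α : ι) (a : ℂ) (s : (x : C) → Z.Fiber x) :
    comp Z α (a • s) = a • comp Z α s := by
  funext x
  exact (Z.coordChange (Z.indexAt x) α x).map_smul _ _

/-- The space of holomorphic sections over `U`. -/
def holSections (U : Opens C) : Submodule ℂ ((x : U) → Z.Fiber x) where
  carrier := {s | ∀ α, ContMDiffOn 𝓘(ℂ, ℂ) 𝓘(ℂ, F) ω (comp Z α (ext0 s)) (U ∩ Z.baseSet α)}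
  add_mem' {s t} hs ht α := by
    rw [ext0_add, comp_add]
    exact (hs α).add (ht α)
  zero_mem' α := by
    have h : comp Z α (ext0 (0 : (x : U) → Z.Fiber x)) = fun _ => 0 := by
      funext x
      have : ext0 (0 : (x : U) → Z.Fiber x) x = 0 := by
        by_cases h : x ∈ U <;> simp [ext0, h]
      simp only [comp, this]
      exact (Z.coordChange (Z.indexAt x) α x).map_zero
    rw [h]
    exact contMDiffOn_const
  smul_mem' a s hs α := by
    rw [ext0_smul, comp_smul]
    exact (contMDiffOn_const (I := 𝓘(ℂ, ℂ)) (I' := 𝓘(ℂ, ℂ)) (c := a)).smul (hs α)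

end Sections

/-! ### The semi-classical limit of a family of ħ-connections, and spectral curves -/

section SemiClassical

variable {C ι F : Type*} [TopologicalSpace C] [ChartedSpace ℂ C]
  [NormedAddCommGroup F] [NormedSpace ℂ F] (Z : ℂ → VectorBundleCore ℂ C F ι)
  (N : (ħ : ℂ) → ((x : C) → (Z ħ).Fiber x) → (x : C) →
    TangentSpace 𝓘(ℂ, ℂ) x →ₗ[ℂ] (Z ħ).Fiber x)

/-- Let `N ħ` be first order operators from sections of `Z ħ` to one-forms with values in `Z ħ`.
`σ : T_x C → End (Z 0)_x` is the semi-classical limit of the family at the covector `η` at `x` if,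
in every local frame,
`exp (-S/ħ) ∘ N ħ ∘ exp (S/ħ)` tends at `x` to multiplication by `σ` as `ħ → 0`, for all
holomorphic functions `S` near `x` with `dS = η` at `x`. -/
def IsSemiclassicalLimitAt (x : C) (η : TangentSpace 𝓘(ℂ, ℂ) x →L[ℂ] ℂ)
    (σ : TangentSpace 𝓘(ℂ, ℂ) x →ₗ[ℂ] Module.End ℂ ((Z 0).Fiber x)) : Prop :=
  ∀ α, x ∈ (Z 0).baseSet α → ∀ (S : C → ℂ) (u : C → F),
    ContMDiffAt 𝓘(ℂ, ℂ) 𝓘(ℂ, ℂ) ω S x → mfderiv 𝓘(ℂ, ℂ) 𝓘(ℂ, ℂ) S x = η →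
    ContMDiffAt 𝓘(ℂ, ℂ) 𝓘(ℂ, F) ω u x →
    ∀ v : TangentSpace 𝓘(ℂ, ℂ) x,
      Filter.Tendsto
        (fun ħ : ℂ => (Z ħ).coordChange ((Z ħ).indexAt x) α x
          (Complex.exp (-(S x / ħ)) •
            N ħ (fun y => Complex.exp (S y / ħ) • ofComp (Z ħ) α u y) x v))
        (𝓝[≠] 0)
        (𝓝 ((Z 0).coordChange ((Z 0).indexAt x) α x (σ v (ofComp (Z 0) α u x))))

/-- The semi-classical limit of the family, as a locus in `T*C`: the zeros of the determinant of
the limit of the conjugated operators. -/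
def semiclassicalLimit : Set (Cotangent C) :=
  {p | ∃ σ, IsSemiclassicalLimitAt Z N p.1 p.2 σ ∧ ∀ v, LinearMap.det (σ v) = 0}

/-- The value of `η - φ` at the point `(x, η)` of `T*C`, for a Higgs field `φ`: an
endomorphism-valued covector at `x`. -/
def tautMinus {Z₀ : VectorBundleCore ℂ C F ι}
    (φ : (x : C) → TangentSpace 𝓘(ℂ, ℂ) x →ₗ[ℂ] Module.End ℂ (Z₀.Fiber x))
    (x : C) (η : TangentSpace 𝓘(ℂ, ℂ) x →L[ℂ] ℂ) :
    TangentSpace 𝓘(ℂ, ℂ) x →ₗ[ℂ] Module.End ℂ (Z₀.Fiber x) :=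
  (η : TangentSpace 𝓘(ℂ, ℂ) x →ₗ[ℂ] ℂ).smulRight 1 - φ x

/-- The Hitchin spectral curve `det (η - φ) = 0` in `T*C`. -/
def spectralCurve {Z₀ : VectorBundleCore ℂ C F ι}
    (φ : (x : C) → TangentSpace 𝓘(ℂ, ℂ) x →ₗ[ℂ] Module.End ℂ (Z₀.Fiber x)) :
    Set (Cotangent C) :=
  {p | ∀ v, LinearMap.det (tautMinus φ p.1 p.2 v) = 0}

end SemiClassical

/-! ### Projective coordinate systems -/

/-- A complex projective coordinate system on `C`: a covering by holomorphic coordinate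
neighbourhoods with fractional linear coordinate changes, together with a lift of the coordinate
changes to an `SL₂(ℂ)`-valued cocycle (i.e. a choice of theta characteristic). -/
structure ProjectiveCoordinates (C ι : Type*) [TopologicalSpace C] [ChartedSpace ℂ C] where
  chart : ι → OpenPartialHomeomorph C ℂ
  mem_maximalAtlas : ∀ α, chart α ∈ IsManifold.maximalAtlas 𝓘(ℂ, ℂ) ω C
  cover : ∀ x, ∃ α, x ∈ (chart α).source
  f : ι → ι → SL(2, ℂ)
  den_ne_zero : ∀ α β, ∀ x ∈ (chart α).source ∩ (chart β).source,
    f α β 1 0 * chart β x + f α β 1 1 ≠ 0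
  mobius : ∀ α β, ∀ x ∈ (chart α).source ∩ (chart β).source,
    chart α x = (f α β 0 0 * chart β x + f α β 0 1) / (f α β 1 0 * chart β x + f α β 1 1)
  cocycle : ∀ α β γ, ((chart α).source ∩ (chart β).source ∩ (chart γ).source).Nonempty →
    f α β * f β γ = f α γ

namespace ProjectiveCoordinates

variable {C ι : Type*} [TopologicalSpace C] [ChartedSpace ℂ C] (P : ProjectiveCoordinates C ι)

/-- The coordinate neighbourhood `U_α`. -/
def dom (α : ι) : Opens C := ⟨(P.chart α).source, (P.chart α).open_source⟩

/-- The transition functions `ξ_αβ = c_αβ z_β + d_αβ` of the theta characteristic `K^{1/2}`. -/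
def ξ (α β : ι) (x : C) : ℂ := P.f α β 1 0 * P.chart β x + P.f α β 1 1

theorem f_self {α : ι} {x : C} (hx : x ∈ (P.chart α).source) : P.f α α = 1 := by
  have h := P.cocycle α α α ⟨x, ⟨hx, hx⟩, hx⟩
  simpa using h

theorem ξ_self {α : ι} {x : C} (hx : x ∈ (P.chart α).source) : P.ξ α α x = 1 := by
  simp [ξ, P.f_self hx]

theorem ξ_ne {α β : ι} {x : C} (hα : x ∈ (P.chart α).source) (hβ : x ∈ (P.chart β).source) :
    P.ξ α β x ≠ 0 := P.den_ne_zero α β x ⟨hα, hβ⟩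

theorem f_row (α β γ : ι) {x : C} (hα : x ∈ (P.chart α).source)
    (hβ : x ∈ (P.chart β).source) (hγ : x ∈ (P.chart γ).source) (j : Fin 2) :
    P.f α γ 1 j = P.f α β 1 0 * P.f β γ 0 j + P.f α β 1 1 * P.f β γ 1 j := by
  rw [← P.cocycle α β γ ⟨x, ⟨hα, hβ⟩, hγ⟩]
  simp [Matrix.mul_apply, Fin.sum_univ_two]

theorem chart_mul_ξ {α β : ι} {x : C} (hα : x ∈ (P.chart α).source)
    (hβ : x ∈ (P.chart β).source) :
    P.chart α x * P.ξ α β x = P.f α β 0 0 * P.chart β x + P.f α β 0 1 := by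
  rw [P.mobius α β x ⟨hα, hβ⟩, ξ, div_mul_cancel₀ _ (P.den_ne_zero α β x ⟨hα, hβ⟩)]

theorem ξ_mul (α β γ : ι) {x : C} (hα : x ∈ (P.chart α).source)
    (hβ : x ∈ (P.chart β).source) (hγ : x ∈ (P.chart γ).source) :
    P.ξ α β x * P.ξ β γ x = P.ξ α γ x := by
  have h := P.chart_mul_ξ hβ hγ
  have h0 := P.f_row α β γ hα hβ hγ 0
  have h1 := P.f_row α β γ hα hβ hγ 1
  have e1 : P.ξ α γ x = P.f α γ 1 0 * P.chart γ x + P.f α γ 1 1 := rfl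
  have e2 : P.ξ α β x = P.f α β 1 0 * P.chart β x + P.f α β 1 1 := rfl
  have e3 : P.ξ β γ x = P.f β γ 1 0 * P.chart γ x + P.f β γ 1 1 := rfl
  rw [e1, h0, h1, e2]
  linear_combination P.f α β 1 0 * h + P.f α β 1 1 * e3

theorem c_rel (α β γ : ι) {x : C} (hα : x ∈ (P.chart α).source)
    (hβ : x ∈ (P.chart β).source) (hγ : x ∈ (P.chart γ).source) :
    P.f α γ 1 0 = P.ξ α β x * P.f β γ 1 0 + P.f α β 1 0 * (P.ξ β γ x)⁻¹ := by
  have h := P.chart_mul_ξ hβ hγ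
  have hne := P.ξ_ne hβ hγ
  have hdet : P.f β γ 0 0 * P.f β γ 1 1 - P.f β γ 0 1 * P.f β γ 1 0 = 1 := by
    have := (P.f β γ).det_coe
    rwa [Matrix.det_fin_two] at this
  rw [P.f_row α β γ hα hβ hγ 0]
  have hz : P.chart β x * P.f β γ 1 0 + (P.ξ β γ x)⁻¹ = P.f β γ 0 0 := by
    field_simp
    rw [mul_assoc, mul_comm (P.f β γ 1 0), ← mul_assoc, h]
    simp only [ξ]
    linear_combination -hdet
  rw [← hz]
  simp only [ξ]
  ring

theorem continuousOn_ξ (α β : ι) : ContinuousOn (P.ξ α β) (P.chart β).source :=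
  (continuousOn_const.mul (P.chart β).continuousOn).add continuousOn_const

/-- A chosen index of a coordinate neighbourhood that contains `x`. -/
def idx (x : C) : ι := (P.cover x).choose

theorem mem_idx (x : C) : x ∈ (P.chart (P.idx x)).source := (P.cover x).choose_spec

/-- The transition functions `g_αβ` of `E_ħ`, with off-diagonal entry
`ħ σ_αβ = - ħ dξ_αβ/dz_β = - ħ c_αβ`. -/
def g (ħ : ℂ) (α β : ι) (x : C) : Matrix (Fin 2) (Fin 2) ℂ :=
  !![P.ξ α β x, -(ħ * P.f α β 1 0); 0, (P.ξ α β x)⁻¹]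

theorem g_mul (ħ : ℂ) (α β γ : ι) {x : C} (hα : x ∈ (P.chart α).source)
    (hβ : x ∈ (P.chart β).source) (hγ : x ∈ (P.chart γ).source) :
    P.g ħ α β x * P.g ħ β γ x = P.g ħ α γ x := by
  have h1 := P.ξ_mul α β γ hα hβ hγ
  have h2 := P.c_rel α β γ hα hβ hγ
  simp only [g, Matrix.mul_fin_two, ← h1, h2, mul_inv]
  congr 1
  ext i j
  fin_cases i <;> fin_cases j <;> simp
  ring

/-- Square matrices as continuous linear maps on column vectors. -/
def toCLM : Matrix (Fin 2) (Fin 2) ℂ →ₗ[ℂ] ((Fin 2 → ℂ) →L[ℂ] (Fin 2 → ℂ)) :=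
  (LinearMap.toContinuousLinearMap (𝕜 := ℂ) (E := Fin 2 → ℂ) (F' := Fin 2 → ℂ)).toLinearMap ∘ₗ
    (Matrix.toLin' (R := ℂ) (m := Fin 2) (n := Fin 2)).toLinearMap

theorem toCLM_apply (A : Matrix (Fin 2) (Fin 2) ℂ) (v : Fin 2 → ℂ) :
    toCLM A v = Matrix.mulVec A v := rfl

/-- The rank two bundle `E_ħ`, an extension of `K^{-1/2}` by `K^{1/2}`: local expressions of its
sections satisfy `Ψ_α = g_αβ Ψ_β`. For `ħ = 0` it is `K^{1/2} ⊕ K^{-1/2}`. -/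
def E (ħ : ℂ) : VectorBundleCore ℂ C (Fin 2 → ℂ) ι where
  baseSet α := (P.chart α).source
  isOpen_baseSet α := (P.chart α).open_source
  indexAt := P.idx
  mem_baseSet_at := P.mem_idx
  coordChange β α x := toCLM (P.g ħ α β x)
  coordChange_self α x hx v := by
    rw [toCLM_apply]
    simp [g, P.ξ_self hx, P.f_self hx, ← Matrix.one_fin_two]
  continuousOn_coordChange β α := by
    refine (LinearMap.continuous_of_finiteDimensional toCLM).comp_continuousOn ?_
    have hξ : ContinuousOn (P.ξ α β) ((P.chart β).source ∩ (P.chart α).source) :=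
      (P.continuousOn_ξ α β).mono Set.inter_subset_left
    refine continuousOn_pi.2 fun i => continuousOn_pi.2 fun j => ?_
    fin_cases i <;> fin_cases j
    · exact hξ
    · exact continuousOn_const
    · exact continuousOn_const
    · exact hξ.inv₀ fun x hx => P.ξ_ne hx.2 hx.1
  coordChange_comp γ β α x hx v := by
    simp only [toCLM_apply, Matrix.mulVec_mulVec]
    rw [P.g_mul ħ α β γ hx.2 hx.1.2 hx.1.1]

/-- The line bundle `K^{-1/2}`: local expressions of its sections satisfy
`ψ_α = ξ_αβ⁻¹ ψ_β`. -/
def invHalf : VectorBundleCore ℂ C ℂ ι where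
  baseSet α := (P.chart α).source
  isOpen_baseSet α := (P.chart α).open_source
  indexAt := P.idx
  mem_baseSet_at := P.mem_idx
  coordChange β α x := (P.ξ α β x)⁻¹ • ContinuousLinearMap.id ℂ ℂ
  coordChange_self α x hx v := by simp [P.ξ_self hx]
  continuousOn_coordChange β α := by
    have hξ : ContinuousOn (P.ξ α β) ((P.chart β).source ∩ (P.chart α).source) :=
      (P.continuousOn_ξ α β).mono Set.inter_subset_left
    exact (hξ.inv₀ fun x hx => P.ξ_ne hx.2 hx.1).smul continuousOn_const
  coordChange_comp γ β α x hx v := by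
    simp [← P.ξ_mul α β γ hx.2 hx.1.2 hx.1.1, mul_assoc, mul_left_comm]

/-- The projection `E_ħ → K^{-1/2}` of the extension, `(Ψ₁, Ψ₂) ↦ Ψ₂` in local frames. -/
def proj {ħ : ℂ} {x : C} (w : (P.E ħ).Fiber x) : P.invHalf.Fiber x :=
  ((show Fin 2 → ℂ from w) 1 : ℂ)

/-! ### The Higgs field and the ħ-connection -/

/-- The matrix `φ_α(q) = X₋ + q_α X₊`. -/
def higgsMatrix (q : quadraticDifferentials C) (α : ι) (x : C) : Matrix (Fin 2) (Fin 2) ℂ :=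
  !![0, coeff q (P.chart α) x; 1, 0]

/-- The differential `dz_α` at `x`. -/
def dchart (α : ι) (x : C) : TangentSpace 𝓘(ℂ, ℂ) x →ₗ[ℂ] ℂ :=
  (mfderiv 𝓘(ℂ, ℂ) 𝓘(ℂ, ℂ) (P.chart α) x : ℂ →L[ℂ] ℂ).toLinearMap

/-- The Higgs field `φ(q) : E_0 → E_0 ⊗ K`, equal to `φ_α(q) dz_α` in the local frame at `x`. -/
def higgs (q : quadraticDifferentials C) (x : C) :
    TangentSpace 𝓘(ℂ, ℂ) x →ₗ[ℂ] Module.End ℂ ((P.E 0).Fiber x) :=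
  (P.dchart (P.idx x) x).smulRight
    (show Module.End ℂ (Fin 2 → ℂ) from Matrix.mulVecLin (P.higgsMatrix q (P.idx x) x))

/-- The differential at `x` of a vector-valued function. -/
def dvec (u : C → Fin 2 → ℂ) (x : C) : TangentSpace 𝓘(ℂ, ℂ) x →ₗ[ℂ] (Fin 2 → ℂ) :=
  (mfderiv 𝓘(ℂ, ℂ) 𝓘(ℂ, Fin 2 → ℂ) u x : ℂ →L[ℂ] (Fin 2 → ℂ)).toLinearMap

/-- The ħ-connection `ħ∇^ħ(q) : E_ħ → E_ħ ⊗ K`, equal to `ħ d - φ_α(q) dz_α` in the local frame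
at `x`. -/
def hbarConn (q : quadraticDifferentials C) (ħ : ℂ) (s : (x : C) → (P.E ħ).Fiber x) (x : C) :
    TangentSpace 𝓘(ℂ, ℂ) x →ₗ[ℂ] (P.E ħ).Fiber x :=
  show TangentSpace 𝓘(ℂ, ℂ) x →ₗ[ℂ] (Fin 2 → ℂ) from
  ħ • dvec (comp (P.E ħ) (P.idx x) s) x
    - (P.dchart (P.idx x) x).smulRight
        (Matrix.mulVec (P.higgsMatrix q (P.idx x) x) (comp (P.E ħ) (P.idx x) s x))

/-! ### The quantum curve -/

/-- The differential operator `ħ² (d/dz_α)² - q` of the quantum curve. -/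
def quantumOp (q : quadraticDifferentials C) (ħ : ℂ) (α : ι) (ψ : C → ℂ) (x : C) : ℂ :=
  ħ ^ 2 * dz (P.chart α) (dz (P.chart α) ψ) x - coeff q (P.chart α) x * ψ x

/-- The flat sections over `U` of the ħ-connection. -/
def flatSections (q : quadraticDifferentials C) (ħ : ℂ) (U : Opens C) :
    Set ((x : U) → (P.E ħ).Fiber x) :=
  {Ψ | Ψ ∈ holSections (P.E ħ) U ∧ ∀ x ∈ U, P.hbarConn q ħ (ext0 Ψ) x = 0}

/-- The holomorphic solutions `ψ ∈ K^{-1/2}` over `U` of `ħ² ψ'' - q ψ = 0`. -/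
def quantumSolutions (q : quadraticDifferentials C) (ħ : ℂ) (U : Opens C) :
    Set ((x : U) → P.invHalf.Fiber x) :=
  {ψ | ψ ∈ holSections P.invHalf U ∧
    ∀ α, ∀ x ∈ U ⊓ P.dom α, P.quantumOp q ħ α (comp P.invHalf α (ext0 ψ)) x = 0}

/-! ### Differential operators and D-modules over a coordinate neighbourhood -/

section DiffOp

variable [IsManifold 𝓘(ℂ, ℂ) ω C] {α : ι} {U : Opens C}

theorem dz_eq_deriv {e : OpenPartialHomeomorph C ℂ}
    (he : e ∈ IsManifold.maximalAtlas 𝓘(ℂ, ℂ) ω C) {f : C → ℂ} {x : C} (hx : x ∈ e.source)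
    (hf : MDifferentiableAt 𝓘(ℂ, ℂ) 𝓘(ℂ, ℂ) f x) :
    dz e f x = deriv (f ∘ e.symm) (e x) := by
  have h1 : MDifferentiableAt 𝓘(ℂ, ℂ) 𝓘(ℂ, ℂ) e.symm (e x) :=
    (contMDiffAt_symm_of_mem_maximalAtlas he (e.map_source hx)).mdifferentiableAt (by simp)
  have h2 := mfderiv_comp_apply_of_eq (x := e x) (g := f) (f := e.symm) hf h1
    (e.left_inv hx) (1 : ℂ)
  rw [mfderiv_eq_fderiv] at h2
  exact h2.symm

/-- The derivation `d/dz_α` of the ring `O(U)`, for `U` contained in `U_α`. -/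
def ddz (hU : U ≤ P.dom α) (a : Hol U) : Hol U where
  val x := dz (P.chart α) (ext0 (V := fun _ => ℂ) a) x
  property := by
    have he := P.mem_maximalAtlas α
    have ha : ContMDiffOn 𝓘(ℂ, ℂ) 𝓘(ℂ, ℂ) ω (ext0 (V := fun _ => ℂ) a) (U : Set C) := by
      intro x hx
      have h : ContMDiffAt 𝓘(ℂ, ℂ) 𝓘(ℂ, ℂ) ω
          (fun y : U => ext0 (V := fun _ => ℂ) a (y : C)) ⟨x, hx⟩ := by
        refine (a.contMDiff ⟨x, hx⟩).congr_of_eventuallyEq (Filter.Eventually.of_forall ?_)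
        intro y
        simp [ext0]
      exact (contMDiffAt_subtype_iff.1 h).contMDiffWithinAt
    have hso : ContMDiffOn 𝓘(ℂ, ℂ) 𝓘(ℂ, ℂ) ω
        (ext0 (V := fun _ => ℂ) a ∘ (P.chart α).symm)
        ((P.chart α).target ∩ (P.chart α).symm ⁻¹' (U : Set C)) :=
      ha.comp ((contMDiffOn_symm_of_mem_maximalAtlas he).mono Set.inter_subset_left)
        Set.inter_subset_right
    have hop : IsOpen ((P.chart α).target ∩ (P.chart α).symm ⁻¹' (U : Set C)) :=
      (P.chart α).isOpen_inter_preimage_symm U.isOpen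
    have hd := (hso.contDiffOn.deriv_of_isOpen (m := ω) hop le_rfl).contMDiffOn
    have hc := hd.comp (((contMDiffOn_of_mem_maximalAtlas he).mono hU))
      (fun x hx => ⟨(P.chart α).map_source (hU hx), by
        simpa [(P.chart α).left_inv (hU hx)] using hx⟩)
    intro x
    have hx : ContMDiffAt 𝓘(ℂ, ℂ) 𝓘(ℂ, ℂ) ω
        (fun y : U => (deriv (ext0 (V := fun _ => ℂ) a ∘ (P.chart α).symm) ∘ P.chart α) (y : C))
        x :=
      contMDiffAt_subtype_iff.2 (hc.contMDiffAt (U.isOpen.mem_nhds x.2))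
    refine hx.congr_of_eventuallyEq (Filter.Eventually.of_forall fun y => ?_)
    exact dz_eq_deriv he (hU y.2)
      ((ha.contMDiffAt (U.isOpen.mem_nhds y.2)).mdifferentiableAt (by simp))

/-- The coefficient `q_α` of a quadratic differential, as an element of the ring `O(U)`. -/
def coeffHol (q : quadraticDifferentials C) (hU : U ≤ P.dom α) : Hol U where
  val x := coeff q (P.chart α) x
  property x := contMDiffAt_subtype_iff.2
    ((q.2 _ (P.mem_maximalAtlas α)).contMDiffAt ((P.chart α).open_source.mem_nhds (hU x.2)))

/-- The relations among functions and `∂ = d/dz_α` in the ring of differential operators: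
`O(U)` is a subalgebra, and `∂ a = a ∂ + da/dz_α`. -/
inductive DiffRel (hU : U ≤ P.dom α) :
    FreeAlgebra ℂ (Hol U ⊕ Unit) → FreeAlgebra ℂ (Hol U ⊕ Unit) → Prop
  | add (a b : Hol U) : DiffRel hU (FreeAlgebra.ι ℂ (Sum.inl (a + b)))
      (FreeAlgebra.ι ℂ (Sum.inl a) + FreeAlgebra.ι ℂ (Sum.inl b))
  | mul (a b : Hol U) : DiffRel hU (FreeAlgebra.ι ℂ (Sum.inl (a * b)))
      (FreeAlgebra.ι ℂ (Sum.inl a) * FreeAlgebra.ι ℂ (Sum.inl b))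
  | const (k : ℂ) : DiffRel hU (FreeAlgebra.ι ℂ (Sum.inl (algebraMap ℂ (Hol U) k)))
      (algebraMap ℂ _ k)
  | leibniz (a : Hol U) : DiffRel hU
      (FreeAlgebra.ι ℂ (Sum.inr ()) * FreeAlgebra.ι ℂ (Sum.inl a))
      (FreeAlgebra.ι ℂ (Sum.inl a) * FreeAlgebra.ι ℂ (Sum.inr ())
        + FreeAlgebra.ι ℂ (Sum.inl (P.ddz hU a)))

/-- The ring `D(U) = O(U)⟨∂⟩` of holomorphic differential operators on an open subset `U` of the
coordinate neighbourhood `U_α`, where `∂ = d/dz_α`. -/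
abbrev DiffOp (hU : U ≤ P.dom α) : Type _ := RingQuot (P.DiffRel hU)

/-- A holomorphic function as a differential operator of order zero. -/
def fn (hU : U ≤ P.dom α) (a : Hol U) : P.DiffOp hU :=
  RingQuot.mkAlgHom ℂ (P.DiffRel hU) (FreeAlgebra.ι ℂ (Sum.inl a))

/-- The differential operator `∂ = d/dz_α`. -/
def del (hU : U ≤ P.dom α) : P.DiffOp hU :=
  RingQuot.mkAlgHom ℂ (P.DiffRel hU) (FreeAlgebra.ι ℂ (Sum.inr ()))

/-- The quantum curve `ħ² ∂² - q_α` as an element of `D(U)`. -/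
def quantumElt (q : quadraticDifferentials C) (ħ : ℂ) (hU : U ≤ P.dom α) : P.DiffOp hU :=
  ħ ^ 2 • P.del hU ^ 2 - P.fn hU (P.coeffHol q hU)

/-- The left `D(U)`-module `D(U) / D(U) (ħ² ∂² - q_α)` of the quantum curve. -/
abbrev QuantumModule (q : quadraticDifferentials C) (ħ : ℂ) (hU : U ≤ P.dom α) : Type _ :=
  P.DiffOp hU ⧸ Submodule.span (P.DiffOp hU) {P.quantumElt q ħ hU}

/-- `ρ` is the `D(U)`-module structure on the sections of `E_ħ` over `U` given by the
ħ-connection `ħ∇^ħ(q)`: functions act by multiplication and `ħ ∂` acts as the contraction of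
`ħ∇^ħ(q)` with the vector field `∂/∂z_α`. -/
def IsDModuleAction (q : quadraticDifferentials C) (ħ : ℂ) (hU : U ≤ P.dom α)
    (ρ : P.DiffOp hU →ₐ[ℂ] Module.End ℂ (holSections (P.E ħ) U)) : Prop :=
  (∀ (a : Hol U) (s : holSections (P.E ħ) U) (x : U),
    (ρ (P.fn hU a) s).1 x = a x • s.1 x) ∧
  ∀ (s : holSections (P.E ħ) U) (x : U),
    ħ • (ρ (P.del hU) s).1 x = P.hbarConn q ħ (ext0 s.1) x (coordVec (P.chart α) x)

end DiffOp

end ProjectiveCoordinates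

end OperSCL

end

open OperSCL OperSCL.ProjectiveCoordinates

namespace OperSCL

section Calculus

variable {C : Type*} [TopologicalSpace C] [ChartedSpace ℂ C] [IsManifold 𝓘(ℂ, ℂ) ω C]
  {F : Type*} [NormedAddCommGroup F] [NormedSpace ℂ F]
  {e : OpenPartialHomeomorph C ℂ} {x : C}

/-- The derivative of a vector-valued function along `d/dz`, for a local coordinate `z = e`. -/
theorem hasDerivAt_comp_symm (he : e ∈ IsManifold.maximalAtlas 𝓘(ℂ, ℂ) ω C) (hx : x ∈ e.source)
    {f : C → F} (hf : MDifferentiableAt 𝓘(ℂ, ℂ) 𝓘(ℂ, F) f x) :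
    HasDerivAt (f ∘ e.symm)
      ((mfderiv 𝓘(ℂ, ℂ) 𝓘(ℂ, F) f x : ℂ →L[ℂ] F) (coordVec e x)) (e x) := by
  have h1 : MDifferentiableAt 𝓘(ℂ, ℂ) 𝓘(ℂ, ℂ) e.symm (e x) :=
    (contMDiffAt_symm_of_mem_maximalAtlas he (e.map_source hx)).mdifferentiableAt (by simp)
  have h2 := mfderiv_comp_apply_of_eq (x := e x) (g := f) (f := e.symm) hf h1
    (e.left_inv hx) (1 : ℂ)
  have h3 : MDifferentiableAt 𝓘(ℂ, ℂ) 𝓘(ℂ, F) (f ∘ e.symm) (e x) :=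
    MDifferentiableAt.comp (e x) (by rwa [e.left_inv hx]) h1
  rw [mfderiv_eq_fderiv] at h2
  have h4 := h3.differentiableAt.hasFDerivAt.hasDerivAt
  exact h4.congr_deriv h2

theorem hasDerivAt_dz (he : e ∈ IsManifold.maximalAtlas 𝓘(ℂ, ℂ) ω C) (hx : x ∈ e.source)
    {f : C → ℂ} (hf : MDifferentiableAt 𝓘(ℂ, ℂ) 𝓘(ℂ, ℂ) f x) :
    HasDerivAt (f ∘ e.symm) (dz e f x) (e x) :=
  hasDerivAt_comp_symm he hx hf

theorem mdifferentiableAt_of_hasDerivAt (he : e ∈ IsManifold.maximalAtlas 𝓘(ℂ, ℂ) ω C)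
    (hx : x ∈ e.source) {f : C → F} {d : F} (hf : HasDerivAt (f ∘ e.symm) d (e x)) :
    MDifferentiableAt 𝓘(ℂ, ℂ) 𝓘(ℂ, F) f x := by
  have h1 : MDifferentiableAt 𝓘(ℂ, ℂ) 𝓘(ℂ, ℂ) e x :=
    (contMDiffAt_of_mem_maximalAtlas he hx).mdifferentiableAt (by simp)
  have h2 : MDifferentiableAt 𝓘(ℂ, ℂ) 𝓘(ℂ, F) (f ∘ e.symm) (e x) :=
    hf.differentiableAt.mdifferentiableAt
  refine (h2.comp x h1).congr_of_eventuallyEq ?_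
  filter_upwards [e.open_source.mem_nhds hx] with y hy
  simp [e.left_inv hy]

theorem dz_eq_of_hasDerivAt (he : e ∈ IsManifold.maximalAtlas 𝓘(ℂ, ℂ) ω C)
    (hx : x ∈ e.source) {f : C → ℂ} {d : ℂ} (hf : HasDerivAt (f ∘ e.symm) d (e x)) :
    dz e f x = d :=
  (hasDerivAt_dz he hx (mdifferentiableAt_of_hasDerivAt he hx hf)).unique hf

theorem dz_congr {f g : C → ℂ} (h : f =ᶠ[𝓝 x] g) : dz e f x = dz e g x := by
  unfold dz
  rw [h.mfderiv_eq]
  rfl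

theorem hasDerivAt_coord (hx : x ∈ e.source) : HasDerivAt (e ∘ e.symm) 1 (e x) := by
  refine (hasDerivAt_id (e x)).congr_of_eventuallyEq ?_
  filter_upwards [e.open_target.mem_nhds (e.map_source hx)] with y hy
  simp [e.right_inv hy]

theorem contDiffAt_comp_symm (he : e ∈ IsManifold.maximalAtlas 𝓘(ℂ, ℂ) ω C) (hx : x ∈ e.source)
    {f : C → F} (hf : ContMDiffAt 𝓘(ℂ, ℂ) 𝓘(ℂ, F) ω f x) : ContDiffAt ℂ ω (f ∘ e.symm) (e x) :=
  ContMDiffAt.contDiffAt (ContMDiffAt.comp (e x) (by rwa [e.left_inv hx])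
    (contMDiffAt_symm_of_mem_maximalAtlas he (e.map_source hx)))

theorem eventually_mdifferentiableAt (he : e ∈ IsManifold.maximalAtlas 𝓘(ℂ, ℂ) ω C)
    (hx : x ∈ e.source) {f : C → F} (hf : ContMDiffAt 𝓘(ℂ, ℂ) 𝓘(ℂ, F) ω f x) :
    ∀ᶠ y in 𝓝 x, MDifferentiableAt 𝓘(ℂ, ℂ) 𝓘(ℂ, F) f y := by
  have h1 := (contDiffAt_comp_symm he hx hf).eventually (by simp)
  filter_upwards [(e.continuousAt hx).eventually h1, e.open_source.mem_nhds hx] with y hy hys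
  exact mdifferentiableAt_of_hasDerivAt he hys (hy.differentiableAt (by simp)).hasDerivAt

/-- The derivative of a holomorphic function in a local coordinate is holomorphic. -/
theorem contMDiffAt_dz (he : e ∈ IsManifold.maximalAtlas 𝓘(ℂ, ℂ) ω C) (hx : x ∈ e.source)
    {f : C → ℂ} (hf : ContMDiffAt 𝓘(ℂ, ℂ) 𝓘(ℂ, ℂ) ω f x) :
    ContMDiffAt 𝓘(ℂ, ℂ) 𝓘(ℂ, ℂ) ω (dz e f) x := by
  have h2 : ContDiffAt ℂ ω (deriv (f ∘ e.symm)) (e x) :=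
    (contDiffAt_comp_symm he hx hf).analyticAt.deriv.contDiffAt
  refine ((h2.contMDiffAt).comp x (contMDiffAt_of_mem_maximalAtlas he hx)).congr_of_eventuallyEq ?_
  filter_upwards [eventually_mdifferentiableAt he hx hf, e.open_source.mem_nhds hx] with y hy hys
  exact dz_eq_deriv he hys hy

end Calculus

namespace ProjectiveCoordinates

variable {C ι : Type*} [TopologicalSpace C] [ChartedSpace ℂ C] [IsManifold 𝓘(ℂ, ℂ) ω C]
  (P : ProjectiveCoordinates C ι) {α β : ι} {x : C}

theorem dchart_coordVec (hx : x ∈ (P.chart α).source) :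
    P.dchart α x (coordVec (P.chart α) x) = 1 :=
  dz_eq_of_hasDerivAt (P.mem_maximalAtlas α) hx (hasDerivAt_coord hx)

theorem eq_dchart_smul (hx : x ∈ (P.chart α).source) (v : TangentSpace 𝓘(ℂ, ℂ) x) :
    v = P.dchart α x v • coordVec (P.chart α) x := by
  have hL : ∀ (L : ℂ →ₗ[ℂ] ℂ) (c w : ℂ), L c = 1 → w = L w • c := by
    intro L c w hc
    have e1 : ∀ c, L c = c * L 1 := fun c => by
      conv_lhs => rw [← mul_one c, ← smul_eq_mul, L.map_smul, smul_eq_mul]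
    rw [e1 c] at hc
    rw [e1 w, smul_eq_mul]
    linear_combination -w * hc
  exact hL (P.dchart α x) _ _ (P.dchart_coordVec hx)

theorem hasDerivAt_ξ (hβ : x ∈ (P.chart β).source) :
    HasDerivAt (P.ξ α β ∘ (P.chart β).symm) (P.f α β 1 0) (P.chart β x) := by
  have := ((hasDerivAt_coord hβ).const_mul (P.f α β 1 0)).add_const (P.f α β 1 1)
  rw [mul_one] at this
  exact this

theorem hasDerivAt_chart (hα : x ∈ (P.chart α).source) (hβ : x ∈ (P.chart β).source) :
    HasDerivAt (P.chart α ∘ (P.chart β).symm) ((P.ξ α β x ^ 2)⁻¹) (P.chart β x) := by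
  have hξ := P.ξ_ne hα hβ
  have hdet : P.f α β 0 0 * P.f α β 1 1 - P.f α β 0 1 * P.f α β 1 0 = 1 := by
    have := (P.f α β).det_coe
    rwa [Matrix.det_fin_two] at this
  have h1 := ((hasDerivAt_coord hβ).const_mul (P.f α β 0 0)).add_const (P.f α β 0 1)
  have h2 := P.hasDerivAt_ξ (α := α) hβ
  have h3 := h1.div h2 (by simpa [(P.chart β).left_inv hβ] using hξ)
  refine (h3.congr_of_eventuallyEq ?_).congr_deriv ?_
  · have ho : IsOpen ((P.chart β).target ∩ (P.chart β).symm ⁻¹' (P.chart α).source) :=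
      (P.chart β).isOpen_inter_preimage_symm (P.chart α).open_source
    filter_upwards [ho.mem_nhds ⟨(P.chart β).map_source hβ, by
      simpa [(P.chart β).left_inv hβ] using hα⟩] with y hy
    have := P.mobius α β ((P.chart β).symm y) ⟨hy.2, (P.chart β).map_target hy.1⟩
    simpa [ξ] using this
  · simp only [Function.comp, (P.chart β).left_inv hβ]
    field_simp
    simp only [ξ]
    linear_combination hdet

theorem dchart_coordVec_of_mem (hα : x ∈ (P.chart α).source) (hβ : x ∈ (P.chart β).source) :
    P.dchart α x (coordVec (P.chart β) x) = (P.ξ α β x ^ 2)⁻¹ :=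
  dz_eq_of_hasDerivAt (P.mem_maximalAtlas β) hβ (P.hasDerivAt_chart hα hβ)

theorem coordVec_eq_smul (hα : x ∈ (P.chart α).source) (hβ : x ∈ (P.chart β).source) :
    coordVec (P.chart β) x = (P.ξ α β x ^ 2)⁻¹ • coordVec (P.chart α) x := by
  conv_lhs => rw [P.eq_dchart_smul hα (coordVec (P.chart β) x), P.dchart_coordVec_of_mem hα hβ]

theorem dz_chart_change (hα : x ∈ (P.chart α).source) (hβ : x ∈ (P.chart β).source)
    (f : C → ℂ) : dz (P.chart α) f x = P.ξ α β x ^ 2 * dz (P.chart β) f x := by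
  have hξ := P.ξ_ne hα hβ
  have h : dz (P.chart β) f x = (P.ξ α β x ^ 2)⁻¹ * dz (P.chart α) f x := by
    unfold dz
    rw [P.coordVec_eq_smul hα hβ]
    exact (mfderiv 𝓘(ℂ, ℂ) 𝓘(ℂ, ℂ) f x : ℂ →L[ℂ] ℂ).map_smul _ _
  rw [h]
  field_simp

theorem coeff_smul (q : quadraticDifferentials C) (t : ℂ) (v : TangentSpace 𝓘(ℂ, ℂ) x) :
    q.1 x (t • v) (t • v) = t ^ 2 * q.1 x v v := by
  simp [pow_two, mul_assoc]

theorem coeff_chart_change (q : quadraticDifferentials C) (hα : x ∈ (P.chart α).source)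
    (hβ : x ∈ (P.chart β).source) :
    coeff q (P.chart α) x = P.ξ α β x ^ 4 * coeff q (P.chart β) x := by
  have hξ := P.ξ_ne hα hβ
  unfold coeff
  rw [P.coordVec_eq_smul hα hβ, coeff_smul]
  field_simp

theorem quadratic_apply (q : quadraticDifferentials C) (hα : x ∈ (P.chart α).source)
    (v : TangentSpace 𝓘(ℂ, ℂ) x) :
    q.1 x v v = P.dchart α x v ^ 2 * coeff q (P.chart α) x := by
  conv_lhs => rw [P.eq_dchart_smul hα v]
  rw [coeff_smul, coeff]

theorem dvec_apply (hα : x ∈ (P.chart α).source) {u : C → Fin 2 → ℂ} {d : Fin 2 → ℂ}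
    (hu : HasDerivAt (u ∘ (P.chart α).symm) d (P.chart α x)) (v : TangentSpace 𝓘(ℂ, ℂ) x) :
    dvec u x v = P.dchart α x v • d := by
  have hm := mdifferentiableAt_of_hasDerivAt (P.mem_maximalAtlas α) hα hu
  have h := (hasDerivAt_comp_symm (P.mem_maximalAtlas α) hα hm).unique hu
  rw [← h]
  conv_lhs => rw [P.eq_dchart_smul hα v]
  exact (mfderiv 𝓘(ℂ, ℂ) 𝓘(ℂ, Fin 2 → ℂ) u x : ℂ →L[ℂ] (Fin 2 → ℂ)).map_smul _ _

end ProjectiveCoordinates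

end OperSCL

namespace OperSCL

namespace ProjectiveCoordinates

variable {C ι : Type*} [TopologicalSpace C] [ChartedSpace ℂ C]
  (P : ProjectiveCoordinates C ι) {α β : ι} {x : C} {ħ : ℂ}

/-! ### Change of frame -/

theorem coordChange_E (ħ : ℂ) (α β : ι) (x : C) (w : Fin 2 → ℂ) :
    (P.E ħ).coordChange β α x w = (P.g ħ α β x).mulVec w := rfl

theorem g_mulVec (ħ : ℂ) (α β : ι) (x : C) (w : Fin 2 → ℂ) :
    (P.g ħ α β x).mulVec w
      = ![P.ξ α β x * w 0 - ħ * P.f α β 1 0 * w 1, (P.ξ α β x)⁻¹ * w 1] := by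
  ext i
  fin_cases i <;> simp [g, Matrix.mulVec, dotProduct, Fin.sum_univ_two, sub_eq_add_neg]

theorem higgsMatrix_mulVec (q : quadraticDifferentials C) (α : ι) (x : C) (w : Fin 2 → ℂ) :
    (P.higgsMatrix q α x).mulVec w = ![coeff q (P.chart α) x * w 1, w 0] := by
  ext i
  fin_cases i <;> simp [higgsMatrix, Matrix.mulVec, dotProduct, Fin.sum_univ_two]

theorem g_mulVec_cancel (ħ : ℂ) (hα : x ∈ (P.chart α).source) (hβ : x ∈ (P.chart β).source)
    (w : Fin 2 → ℂ) : (P.g ħ α β x).mulVec ((P.g ħ β α x).mulVec w) = w := by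
  rw [Matrix.mulVec_mulVec, P.g_mul ħ α β α hα hβ hα]
  exact (P.E ħ).coordChange_self α x hα w

theorem comp_E_change (hα : x ∈ (P.chart α).source) (hβ : x ∈ (P.chart β).source)
    (s : (x : C) → (P.E ħ).Fiber x) :
    comp (P.E ħ) β s x = (P.g ħ β α x).mulVec (comp (P.E ħ) α s x) :=
  ((P.E ħ).coordChange_comp (P.idx x) α β x ⟨⟨P.mem_idx x, hα⟩, hβ⟩ (s x)).symm

theorem comp_ofComp_E (hα : x ∈ (P.chart α).source) (u : C → Fin 2 → ℂ) :
    comp (P.E ħ) α (ofComp (P.E ħ) α u) x = u x :=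
  P.g_mulVec_cancel ħ hα (P.mem_idx x) (u x)

theorem comp_E_idx (s : (x : C) → (P.E ħ).Fiber x) (x : C) :
    comp (P.E ħ) (P.idx x) s x = s x :=
  (P.E ħ).coordChange_self (P.idx x) x (P.mem_idx x) (s x)

theorem comp_invHalf_change (hα : x ∈ (P.chart α).source) (hβ : x ∈ (P.chart β).source)
    (s : (x : C) → P.invHalf.Fiber x) :
    comp P.invHalf α s x = (P.ξ α β x)⁻¹ * comp P.invHalf β s x :=
  (P.invHalf.coordChange_comp (P.idx x) β α x ⟨⟨P.mem_idx x, hβ⟩, hα⟩ (s x)).symm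

theorem comp_invHalf_idx (s : (x : C) → P.invHalf.Fiber x) (x : C) :
    comp P.invHalf (P.idx x) s x = s x :=
  P.invHalf.coordChange_self (P.idx x) x (P.mem_idx x) (s x)

variable [IsManifold 𝓘(ℂ, ℂ) ω C]

theorem comp_symm_eventuallyEq {e : OpenPartialHomeomorph C ℂ} {X : Type*} (hx : x ∈ e.source)
    {f g : C → X} (h : f =ᶠ[𝓝 x] g) : f ∘ e.symm =ᶠ[𝓝 (e x)] g ∘ e.symm := by
  have h1 : Filter.Tendsto e.symm (𝓝 (e x)) (𝓝 x) := by
    have h2 := e.continuousAt_symm (e.map_source hx)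
    rwa [ContinuousAt, e.left_inv hx] at h2
  exact h1.eventually h

/-! ### The ħ-connection in a projective coordinate -/

/-- The ħ-connection is `ħ d - φ_α(q) dz_α` in the frame over every `U_α`. -/
theorem coordChange_hbarConn (q : quadraticDifferentials C) (hα : x ∈ (P.chart α).source)
    {s : (x : C) → (P.E ħ).Fiber x} {d : Fin 2 → ℂ}
    (hs : HasDerivAt (comp (P.E ħ) α s ∘ (P.chart α).symm) d (P.chart α x))
    (v : TangentSpace 𝓘(ℂ, ℂ) x) :
    (P.E ħ).coordChange (P.idx x) α x (P.hbarConn q ħ s x v)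
      = P.dchart α x v •
          (ħ • d - (P.higgsMatrix q α x).mulVec (comp (P.E ħ) α s x)) := by
  have hβ := P.mem_idx x
  set β := P.idx x
  set u := comp (P.E ħ) α s
  have hξ := P.ξ_ne hβ hα
  have h0 : HasDerivAt (fun z => u ((P.chart α).symm z) 0) (d 0) (P.chart α x) :=
    (hasDerivAt_pi.1 hs) 0
  have h1 : HasDerivAt (fun z => u ((P.chart α).symm z) 1) (d 1) (P.chart α x) :=
    (hasDerivAt_pi.1 hs) 1
  have hx' := (P.chart α).left_inv hα
  have hξd := P.hasDerivAt_ξ (α := β) hα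
  have hξi := hξd.inv (by simpa [hx'] using hξ)
  have hev : comp (P.E ħ) β s =ᶠ[𝓝 x] fun y =>
      ![P.ξ β α y * u y 0 - ħ * P.f β α 1 0 * u y 1, (P.ξ β α y)⁻¹ * u y 1] := by
    filter_upwards [(P.chart α).open_source.mem_nhds hα, (P.chart β).open_source.mem_nhds hβ]
      with y hyα hyβ
    rw [P.comp_E_change hyα hyβ, g_mulVec]
  have hd : HasDerivAt (comp (P.E ħ) β s ∘ (P.chart α).symm)
      ![P.f β α 1 0 * u x 0 + P.ξ β α x * d 0 - ħ * P.f β α 1 0 * d 1,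
        -P.f β α 1 0 / P.ξ β α x ^ 2 * u x 1 + (P.ξ β α x)⁻¹ * d 1] (P.chart α x) := by
    refine HasDerivAt.congr_of_eventuallyEq ?_ (comp_symm_eventuallyEq hα hev)
    refine hasDerivAt_pi.2 fun i => ?_
    fin_cases i
    · refine ((hξd.mul h0).sub (h1.const_mul (ħ * P.f β α 1 0))).congr_deriv ?_
      simp [hx']
    · refine (hξi.mul h1).congr_deriv ?_
      simp [hx']
  have hv : P.dchart β x v = P.dchart α x v * (P.ξ β α x ^ 2)⁻¹ := by
    conv_lhs => rw [P.eq_dchart_smul hα v]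
    rw [map_smul, P.dchart_coordVec_of_mem hβ hα, smul_eq_mul]
  have key : P.hbarConn q ħ s x v = (P.g ħ β α x).mulVec (P.dchart α x v •
      (ħ • d - (P.higgsMatrix q α x).mulVec (u x))) := by
    change ħ • dvec (comp (P.E ħ) β s) x v
      - P.dchart β x v • (P.higgsMatrix q β x).mulVec (comp (P.E ħ) β s x) = _
    rw [P.dvec_apply hα hd, hv, hev.self_of_nhds, higgsMatrix_mulVec, higgsMatrix_mulVec,
      g_mulVec, P.coeff_chart_change q hβ hα]
    ext i
    fin_cases i
    · simp [Matrix.vecHead, Matrix.vecTail]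
      field_simp
      ring
    · simp [Matrix.vecHead, Matrix.vecTail]
      field_simp
      ring
  rw [key, coordChange_E]
  exact P.g_mulVec_cancel ħ hα hβ _

theorem hbarConn_coordVec (q : quadraticDifferentials C) (hα : x ∈ (P.chart α).source)
    {s : (x : C) → (P.E ħ).Fiber x}
    (hs : MDifferentiableAt 𝓘(ℂ, ℂ) 𝓘(ℂ, Fin 2 → ℂ) (comp (P.E ħ) α s) x) :
    comp (P.E ħ) α (fun y => P.hbarConn q ħ s y (coordVec (P.chart α) y)) x
      = ![ħ * dz (P.chart α) (fun y => comp (P.E ħ) α s y 0) x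
            - coeff q (P.chart α) x * comp (P.E ħ) α s x 1,
          ħ * dz (P.chart α) (fun y => comp (P.E ħ) α s y 1) x - comp (P.E ħ) α s x 0] := by
  obtain ⟨d, hd⟩ : ∃ d, HasDerivAt (comp (P.E ħ) α s ∘ (P.chart α).symm) d (P.chart α x) :=
    ⟨_, hasDerivAt_comp_symm (P.mem_maximalAtlas α) hα hs⟩
  have h := P.coordChange_hbarConn q hα hd (coordVec (P.chart α) x)
  have hi : ∀ i, dz (P.chart α) (fun y => comp (P.E ħ) α s y i) x = _ := fun i =>
    dz_eq_of_hasDerivAt (P.mem_maximalAtlas α) hα ((hasDerivAt_pi.1 hd) i)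
  rw [hi, hi]
  refine h.trans ?_
  rw [P.dchart_coordVec hα, one_smul, higgsMatrix_mulVec]
  ext i
  fin_cases i <;> simp

theorem mdifferentiableAt_comp {F : Type*} [NormedAddCommGroup F] [NormedSpace ℂ F]
    (Z : VectorBundleCore ℂ C F ι) {U : Opens C} {s : (x : U) → Z.Fiber x}
    (hs : s ∈ holSections Z U) (hU : x ∈ U) (hα : x ∈ Z.baseSet α) :
    MDifferentiableAt 𝓘(ℂ, ℂ) 𝓘(ℂ, F) (comp Z α (ext0 s)) x :=
  ((hs α).contMDiffAt ((U.isOpen.inter (Z.isOpen_baseSet α)).mem_nhds ⟨hU, hα⟩)).mdifferentiableAt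
    (by simp)

theorem contMDiffAt_comp {F : Type*} [NormedAddCommGroup F] [NormedSpace ℂ F]
    (Z : VectorBundleCore ℂ C F ι) {U : Opens C} {s : (x : U) → Z.Fiber x}
    (hs : s ∈ holSections Z U) (hU : x ∈ U) (hα : x ∈ Z.baseSet α) :
    ContMDiffAt 𝓘(ℂ, ℂ) 𝓘(ℂ, F) ω (comp Z α (ext0 s)) x :=
  (hs α).contMDiffAt ((U.isOpen.inter (Z.isOpen_baseSet α)).mem_nhds ⟨hU, hα⟩)

/-! ### Semi-classical limits -/

theorem det_tautMinus (q : quadraticDifferentials C) (η : TangentSpace 𝓘(ℂ, ℂ) x →L[ℂ] ℂ)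
    (v : TangentSpace 𝓘(ℂ, ℂ) x) :
    LinearMap.det (tautMinus (P.higgs q) x η v) = η v ^ 2 - q.1 x v v := by
  have h : tautMinus (P.higgs q) x η v
      = Matrix.toLin' (η v • (1 : Matrix (Fin 2) (Fin 2) ℂ)
          - P.dchart (P.idx x) x v • P.higgsMatrix q (P.idx x) x) := by
    rw [map_sub, map_smul, map_smul, Matrix.toLin'_one]
    rfl
  rw [h]
  refine (LinearMap.det_toLin' _).trans ?_
  rw [Matrix.det_fin_two, P.quadratic_apply q (P.mem_idx x)]
  simp [higgsMatrix]
  ring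

theorem hasDerivAt_exp_div {S : ℂ → ℂ} {S' z : ℂ} (ħ : ℂ) (hS : HasDerivAt S S' z) :
    HasDerivAt (fun z => Complex.exp (S z / ħ)) (Complex.exp (S z / ħ) * (S' / ħ)) z :=
  (hS.div_const ħ).cexp

theorem tautMinus_coordChange (q : quadraticDifferentials C) (hα : x ∈ (P.chart α).source)
    (η : TangentSpace 𝓘(ℂ, ℂ) x →L[ℂ] ℂ) (v : TangentSpace 𝓘(ℂ, ℂ) x) (w : Fin 2 → ℂ) :
    (P.E 0).coordChange (P.idx x) α x
        (tautMinus (P.higgs q) x η v ((P.E 0).coordChange α (P.idx x) x w))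
      = η v • w - P.dchart α x v • (P.higgsMatrix q α x).mulVec w := by
  have hβ := P.mem_idx x
  have h : tautMinus (P.higgs q) x η v ((P.E 0).coordChange α (P.idx x) x w)
      = η v • (P.g 0 (P.idx x) α x).mulVec w - P.dchart (P.idx x) x v •
          (P.higgsMatrix q (P.idx x) x).mulVec ((P.g 0 (P.idx x) α x).mulVec w) := rfl
  rw [h, coordChange_E]
  set β := P.idx x
  have hξ := P.ξ_ne hβ hα
  have hv : P.dchart β x v = P.dchart α x v * (P.ξ β α x ^ 2)⁻¹ := by
    conv_lhs => rw [P.eq_dchart_smul hα v]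
    rw [map_smul, P.dchart_coordVec_of_mem hβ hα, smul_eq_mul]
  have key : η v • (P.g 0 β α x).mulVec w - P.dchart β x v •
        (P.higgsMatrix q β x).mulVec ((P.g 0 β α x).mulVec w)
      = (P.g 0 β α x).mulVec (η v • w - P.dchart α x v • (P.higgsMatrix q α x).mulVec w) := by
    rw [hv, higgsMatrix_mulVec, higgsMatrix_mulVec, g_mulVec, g_mulVec,
      P.coeff_chart_change q hβ hα]
    ext i
    fin_cases i
    · simp
      field_simp
    · simp
      field_simp
  exact (congrArg _ key).trans (P.g_mulVec_cancel 0 hα hβ _)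

theorem isSemiclassicalLimitAt_tautMinus (q : quadraticDifferentials C)
    (η : TangentSpace 𝓘(ℂ, ℂ) x →L[ℂ] ℂ) :
    IsSemiclassicalLimitAt P.E (P.hbarConn q) x η (tautMinus (P.higgs q) x η) := by
  intro α hα S u hS hη hu v
  replace hα : x ∈ (P.chart α).source := hα
  have he := P.mem_maximalAtlas α
  have hSd := hasDerivAt_comp_symm he hα (hS.mdifferentiableAt (by simp))
  have hud := hasDerivAt_comp_symm he hα (hu.mdifferentiableAt (by simp))
  set S' : ℂ := (mfderiv 𝓘(ℂ, ℂ) 𝓘(ℂ, ℂ) S x : ℂ →L[ℂ] ℂ) (coordVec (P.chart α) x)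
  set u' : Fin 2 → ℂ := (mfderiv 𝓘(ℂ, ℂ) 𝓘(ℂ, Fin 2 → ℂ) u x : ℂ →L[ℂ] (Fin 2 → ℂ))
    (coordVec (P.chart α) x)
  have hx' := (P.chart α).left_inv hα
  have hηv : η v = P.dchart α x v * S' := by
    conv_lhs => rw [P.eq_dchart_smul hα v, map_smul, smul_eq_mul, ← hη]
    rfl
  have hlim := P.tautMinus_coordChange q hα η v (u x)
  change Filter.Tendsto _ _ (𝓝 ((P.E 0).coordChange (P.idx x) α x
        (tautMinus (P.higgs q) x η v ((P.E 0).coordChange α (P.idx x) x (u x)))))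
  rw [hlim]
  have hmain : ∀ ħ : ℂ, ħ ≠ 0 → (P.E ħ).coordChange ((P.E ħ).indexAt x) α x
      (Complex.exp (-(S x / ħ)) • P.hbarConn q ħ
        (fun y => Complex.exp (S y / ħ) • ofComp (P.E ħ) α u y) x v)
      = (η v • u x - P.dchart α x v • (P.higgsMatrix q α x).mulVec (u x))
        + ħ • (P.dchart α x v • u') := by
    intro ħ hħ
    have hev : comp (P.E ħ) α (fun y => Complex.exp (S y / ħ) • ofComp (P.E ħ) α u y)
        =ᶠ[𝓝 x] fun y => Complex.exp (S y / ħ) • u y := by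
      filter_upwards [(P.chart α).open_source.mem_nhds hα] with y hy
      rw [← P.comp_ofComp_E (ħ := ħ) hy u]
      exact ((P.E ħ).coordChange (P.idx y) α y).map_smul _ _
    have hd := ((hasDerivAt_exp_div ħ hSd).smul hud).congr_of_eventuallyEq
      (comp_symm_eventuallyEq hα hev)
    refine (((P.E ħ).coordChange ((P.E ħ).indexAt x) α x).map_smul _ _).trans ?_
    refine (congrArg _ (P.coordChange_hbarConn q hα hd v)).trans ?_
    rw [hev.self_of_nhds, Matrix.mulVec_smul, hηv, Complex.exp_neg]
    have hne := Complex.exp_ne_zero (S x / ħ)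
    simp only [Function.comp, hx']
    generalize (P.higgsMatrix q α x).mulVec (u x) = w
    ext i
    simp only [Pi.smul_apply, Pi.add_apply, Pi.sub_apply, smul_eq_mul]
    field_simp
    ring
  refine Filter.Tendsto.congr' (f₁ := fun ħ : ℂ =>
    (η v • u x - P.dchart α x v • (P.higgsMatrix q α x).mulVec (u x))
        + ħ • (P.dchart α x v • u')) ?_ ?_
  · filter_upwards [self_mem_nhdsWithin] with ħ hħ
    exact (hmain ħ hħ).symm
  · have hc : Continuous fun ħ : ℂ =>
      (η v • u x - P.dchart α x v • (P.higgsMatrix q α x).mulVec (u x))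
        + ħ • (P.dchart α x v • u') := by fun_prop
    have := (hc.tendsto 0).mono_left (nhdsWithin_le_nhds (s := {0}ᶜ))
    simpa using this

theorem exists_contMDiffAt_mfderiv_eq (hα : x ∈ (P.chart α).source)
    (η : TangentSpace 𝓘(ℂ, ℂ) x →L[ℂ] ℂ) :
    ∃ S : C → ℂ, ContMDiffAt 𝓘(ℂ, ℂ) 𝓘(ℂ, ℂ) ω S x ∧ mfderiv 𝓘(ℂ, ℂ) 𝓘(ℂ, ℂ) S x = η := by
  have he := P.mem_maximalAtlas α
  have hS : ContMDiffAt 𝓘(ℂ, ℂ) 𝓘(ℂ, ℂ) ω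
      (fun y => η (coordVec (P.chart α) x) * P.chart α y) x :=
    contMDiffAt_const.mul (contMDiffAt_of_mem_maximalAtlas he hα)
  refine ⟨_, hS, ?_⟩
  have h1 := (hasDerivAt_coord hα).const_mul (η (coordVec (P.chart α) x))
  rw [mul_one] at h1
  have h2 := (hasDerivAt_comp_symm he hα (hS.mdifferentiableAt (by simp))).unique h1
  refine ContinuousLinearMap.ext fun v => ?_
  rw [P.eq_dchart_smul hα v]
  exact ((mfderiv 𝓘(ℂ, ℂ) 𝓘(ℂ, ℂ) _ x : ℂ →L[ℂ] ℂ).map_smul _ _).trans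
    ((congrArg _ h2).trans (η.map_smul _ _).symm)

theorem semiclassicalLimit_eq_spectralCurve (q : quadraticDifferentials C) :
    semiclassicalLimit P.E (P.hbarConn q) = spectralCurve (P.higgs q) := by
  ext p
  constructor
  · rintro ⟨σ, hσ, hdet⟩ v
    have hx := P.mem_idx p.1
    obtain ⟨S, hS, hη⟩ := P.exists_contMDiffAt_mfderiv_eq hx p.2
    have h : tautMinus (P.higgs q) p.1 p.2 v = σ v := by
      refine LinearMap.ext fun w => ?_
      have h1 := P.isSemiclassicalLimitAt_tautMinus q p.2 (P.idx p.1) hx S (fun _ => w) hS hη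
        contMDiffAt_const v
      have h2 := hσ (P.idx p.1) hx S (fun _ => w) hS hη contMDiffAt_const v
      have h3 := tendsto_nhds_unique h1 h2
      have hid : ∀ w', (P.E 0).coordChange (P.idx p.1) (P.idx p.1) p.1 w' = w' :=
        (P.E 0).coordChange_self _ _ hx
      have hw : ofComp (P.E 0) (P.idx p.1) (fun _ => w) p.1 = w := hid w
      rw [hw] at h3
      exact (hid _).symm.trans (h3.trans (hid _))
    rw [h]
    exact hdet v
  · exact fun h => ⟨_, P.isSemiclassicalLimitAt_tautMinus q p.2, h⟩

theorem mem_spectralCurve_iff (q : quadraticDifferentials C) (p : Cotangent C)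
    (hα : p.1 ∈ (P.chart α).source) :
    p ∈ spectralCurve (P.higgs q) ↔
      p.2 (coordVec (P.chart α) p.1) ^ 2 - coeff q (P.chart α) p.1 = 0 := by
  constructor
  · intro h
    rw [← h (coordVec (P.chart α) p.1), det_tautMinus, coeff]
  · intro h v
    have hv : p.2 v = P.dchart α p.1 v * p.2 (coordVec (P.chart α) p.1) := by
      conv_lhs => rw [P.eq_dchart_smul hα v, map_smul, smul_eq_mul]
    rw [det_tautMinus, P.quadratic_apply q hα, hv]
    linear_combination P.dchart α p.1 v ^ 2 * h

theorem tendsto_quantumOp (q : quadraticDifferentials C) (hα : x ∈ (P.chart α).source)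
    {S u : C → ℂ} (hS : ContMDiffAt 𝓘(ℂ, ℂ) 𝓘(ℂ, ℂ) ω S x)
    (hu : ContMDiffAt 𝓘(ℂ, ℂ) 𝓘(ℂ, ℂ) ω u x) :
    Filter.Tendsto
      (fun ħ : ℂ => Complex.exp (-(S x / ħ)) *
        P.quantumOp q ħ α (fun y => Complex.exp (S y / ħ) * u y) x)
      (𝓝[≠] 0)
      (𝓝 ((dz (P.chart α) S x ^ 2 - coeff q (P.chart α) x) * u x)) := by
  have he := P.mem_maximalAtlas α
  set e := P.chart α
  have hx' := e.left_inv hα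
  have hSd := hasDerivAt_dz he hα (hS.mdifferentiableAt (by simp))
  have hud := hasDerivAt_dz he hα (hu.mdifferentiableAt (by simp))
  have hSdd := hasDerivAt_dz he hα ((contMDiffAt_dz he hα hS).mdifferentiableAt (by simp))
  have hudd := hasDerivAt_dz he hα ((contMDiffAt_dz he hα hu).mdifferentiableAt (by simp))
  set S₁ := dz e S
  set u₁ := dz e u
  have hmain : ∀ ħ : ℂ, ħ ≠ 0 → Complex.exp (-(S x / ħ)) *
      P.quantumOp q ħ α (fun y => Complex.exp (S y / ħ) * u y) x
      = (S₁ x ^ 2 - coeff q e x) * u x + ħ * (2 * S₁ x * u₁ x + dz e S₁ x * u x)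
        + ħ ^ 2 * dz e u₁ x := by
    intro ħ hħ
    have hev : dz e (fun y => Complex.exp (S y / ħ) * u y) =ᶠ[𝓝 x] fun y =>
        Complex.exp (S y / ħ) * (S₁ y / ħ * u y + u₁ y) := by
      filter_upwards [eventually_mdifferentiableAt he hα hS, eventually_mdifferentiableAt he hα hu,
        e.open_source.mem_nhds hα] with y hyS hyu hy
      refine (dz_eq_of_hasDerivAt
        (f := fun y => Complex.exp (S y / ħ) * u y) he hy ((hasDerivAt_exp_div ħ (hasDerivAt_dz he hy hyS)).mul
        (hasDerivAt_dz he hy hyu))).trans ?_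
      simp only [Function.comp, e.left_inv hy]
      ring
    have h2 : dz e (dz e (fun y => Complex.exp (S y / ħ) * u y)) x
        = Complex.exp (S x / ħ) * (S₁ x / ħ * (S₁ x / ħ * u x + u₁ x)
          + (dz e S₁ x / ħ * u x + S₁ x / ħ * u₁ x + dz e u₁ x)) := by
      rw [dz_congr hev]
      refine (dz_eq_of_hasDerivAt
        (f := fun y => Complex.exp (S y / ħ) * (S₁ y / ħ * u y + u₁ y)) he hα ((hasDerivAt_exp_div ħ hSd).mul
        (((hSdd.div_const ħ).mul hud).add hudd))).trans ?_
      simp only [Function.comp, hx']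
      ring
    rw [quantumOp, h2, Complex.exp_neg]
    have hne := Complex.exp_ne_zero (S x / ħ)
    field_simp
    ring
  refine Filter.Tendsto.congr' (f₁ := fun ħ : ℂ =>
    (S₁ x ^ 2 - coeff q e x) * u x + ħ * (2 * S₁ x * u₁ x + dz e S₁ x * u x)
        + ħ ^ 2 * dz e u₁ x) ?_ ?_
  · filter_upwards [self_mem_nhdsWithin] with ħ hħ
    exact (hmain ħ hħ).symm
  · have hc : Continuous fun ħ : ℂ =>
      (S₁ x ^ 2 - coeff q e x) * u x + ħ * (2 * S₁ x * u₁ x + dz e S₁ x * u x)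
        + ħ ^ 2 * dz e u₁ x := by fun_prop
    have := (hc.tendsto 0).mono_left (nhdsWithin_le_nhds (s := {0}ᶜ))
    simpa using this

end ProjectiveCoordinates

end OperSCL

namespace OperSCL

namespace ProjectiveCoordinates

variable {C ι : Type*} [TopologicalSpace C] [ChartedSpace ℂ C] [IsManifold 𝓘(ℂ, ℂ) ω C]
  (P : ProjectiveCoordinates C ι) {α β : ι} {x : C} {ħ : ℂ}

/-! ### The quantum curve on `K^{-1/2}` -/

theorem dz_comp_invHalf_change (hα : x ∈ (P.chart α).source) (hβ : x ∈ (P.chart β).source)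
    {s : (x : C) → P.invHalf.Fiber x}
    (hs : MDifferentiableAt 𝓘(ℂ, ℂ) 𝓘(ℂ, ℂ) (comp P.invHalf β s) x) :
    dz (P.chart α) (comp P.invHalf α s) x
      = P.ξ α β x * dz (P.chart β) (comp P.invHalf β s) x
        - P.f α β 1 0 * comp P.invHalf β s x := by
  have hξ := P.ξ_ne hα hβ
  have hx' := (P.chart β).left_inv hβ
  have hev : comp P.invHalf α s =ᶠ[𝓝 x] fun y => (P.ξ α β y)⁻¹ * comp P.invHalf β s y := by
    filter_upwards [(P.chart α).open_source.mem_nhds hα, (P.chart β).open_source.mem_nhds hβ]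
      with y hyα hyβ
    exact P.comp_invHalf_change hyα hyβ s
  have hd := ((P.hasDerivAt_ξ (α := α) hβ).inv (by simpa [hx'] using hξ)).mul
    (hasDerivAt_dz (P.mem_maximalAtlas β) hβ hs)
  rw [P.dz_chart_change hα hβ, dz_congr hev, dz_eq_of_hasDerivAt
    (f := fun y => (P.ξ α β y)⁻¹ * comp P.invHalf β s y) (P.mem_maximalAtlas β) hβ hd]
  simp only [Pi.inv_apply, Function.comp, hx']
  field_simp
  ring

/-- The operator `ħ² (d/dz)² - q` maps sections of `K^{-1/2}` to sections of `K^{3/2}`. -/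
theorem quantumOp_comp_invHalf_change (q : quadraticDifferentials C)
    (hα : x ∈ (P.chart α).source) (hβ : x ∈ (P.chart β).source)
    {s : (x : C) → P.invHalf.Fiber x}
    (hs : ContMDiffAt 𝓘(ℂ, ℂ) 𝓘(ℂ, ℂ) ω (comp P.invHalf β s) x) :
    P.quantumOp q ħ α (comp P.invHalf α s) x
      = P.ξ α β x ^ 3 * P.quantumOp q ħ β (comp P.invHalf β s) x := by
  have he := P.mem_maximalAtlas β
  have hξ := P.ξ_ne hα hβ
  have hx' := (P.chart β).left_inv hβ
  set ψ := comp P.invHalf β s with hψ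
  have hev : dz (P.chart α) (comp P.invHalf α s) =ᶠ[𝓝 x] fun y =>
      P.ξ α β y * dz (P.chart β) ψ y - P.f α β 1 0 * ψ y := by
    filter_upwards [(P.chart α).open_source.mem_nhds hα, (P.chart β).open_source.mem_nhds hβ,
      eventually_mdifferentiableAt he hβ hs] with y hyα hyβ hy
    exact P.dz_comp_invHalf_change hyα hyβ hy
  have hd1 := hasDerivAt_dz he hβ (hs.mdifferentiableAt (by simp))
  have hd2 := hasDerivAt_dz he hβ ((contMDiffAt_dz he hβ hs).mdifferentiableAt (by simp))
  have hd := ((P.hasDerivAt_ξ (α := α) hβ).mul hd2).sub (hd1.const_mul (P.f α β 1 0))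
  rw [quantumOp, quantumOp, dz_congr hev, P.dz_chart_change hα hβ, dz_eq_of_hasDerivAt
    (f := fun y => P.ξ α β y * dz (P.chart β) ψ y - P.f α β 1 0 * ψ y) he hβ hd,
    P.comp_invHalf_change hα hβ, ← hψ, P.coeff_chart_change q hα hβ]
  simp only [Function.comp, hx']
  field_simp
  ring

/-! ### Flat sections -/

theorem hbarConn_eq_zero_iff (q : quadraticDifferentials C) (hα : x ∈ (P.chart α).source)
    {s : (x : C) → (P.E ħ).Fiber x}
    (hs : MDifferentiableAt 𝓘(ℂ, ℂ) 𝓘(ℂ, Fin 2 → ℂ) (comp (P.E ħ) α s) x) :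
    P.hbarConn q ħ s x = 0 ↔
      ħ * dz (P.chart α) (fun y => comp (P.E ħ) α s y 0) x
          = coeff q (P.chart α) x * comp (P.E ħ) α s x 1 ∧
        ħ * dz (P.chart α) (fun y => comp (P.E ħ) α s y 1) x = comp (P.E ħ) α s x 0 := by
  have h := P.hbarConn_coordVec q hα hs
  constructor
  · intro h0
    have h1 : comp (P.E ħ) α (fun y => P.hbarConn q ħ s y (coordVec (P.chart α) y)) x = 0 := by
      refine (congrArg ((P.E ħ).coordChange (P.idx x) α x)
        (LinearMap.congr_fun h0 (coordVec (P.chart α) x))).trans ?_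
      exact map_zero _
    rw [h1] at h
    exact ⟨(sub_eq_zero.1 (congrFun h 0).symm), (sub_eq_zero.1 (congrFun h 1).symm)⟩
  · rintro ⟨h0, h1⟩
    have hz : (![0, 0] : Fin 2 → ℂ) = 0 := by
      ext i
      fin_cases i <;> rfl
    rw [sub_eq_zero.2 h0, sub_eq_zero.2 h1, hz] at h
    have h2 : P.hbarConn q ħ s x (coordVec (P.chart α) x) = 0 := by
      refine (P.g_mulVec_cancel ħ (P.mem_idx x) hα _).symm.trans ?_
      exact (congrArg _ h).trans (Matrix.mulVec_zero _)
    refine LinearMap.ext fun v => ?_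
    rw [P.eq_dchart_smul hα v, map_smul, h2, smul_zero]
    rfl

theorem ext0_of_mem {V : C → Type*} [∀ x, Zero (V x)] {U : Opens C} (s : (x : U) → V x)
    (hx : x ∈ U) : ext0 s x = s ⟨x, hx⟩ := by
  simp [ext0, hx]

theorem comp_ext0_proj {U : Opens C} (Ψ : (x : U) → (P.E ħ).Fiber x) (α : ι) :
    comp P.invHalf α (ext0 fun y : U => P.proj (Ψ y))
      = fun y => comp (P.E ħ) α (ext0 Ψ) y 1 := by
  funext y
  have h : ext0 (V := P.invHalf.Fiber) (fun y : U => P.proj (Ψ y)) y = P.proj (ext0 Ψ y) := by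
    by_cases hy : y ∈ U
    · rw [ext0_of_mem _ hy, ext0_of_mem _ hy]
    · simp only [ext0, hy, dif_neg, not_false_iff]
      rfl
  exact (congrArg (P.invHalf.coordChange (P.idx y) α y) h).trans
    (congrFun (P.g_mulVec ħ α (P.idx y) y (ext0 Ψ y)) 1).symm

theorem comp_ext0_eq_of_mem_flatSections {q : quadraticDifferentials C} {U : Opens C}
    {Ψ : (x : U) → (P.E ħ).Fiber x} (hΨ : Ψ ∈ P.flatSections q ħ U) (hU : x ∈ U)
    (hα : x ∈ (P.chart α).source) :
    comp (P.E ħ) α (ext0 Ψ) x =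
      ![ħ * dz (P.chart α) (comp P.invHalf α (ext0 (fun y : U => P.proj (Ψ y)))) x,
        comp P.invHalf α (ext0 (fun y : U => P.proj (Ψ y))) x] := by
  have h := (P.hbarConn_eq_zero_iff q hα (mdifferentiableAt_comp _ hΨ.1 hU hα)).1 (hΨ.2 x hU)
  rw [comp_ext0_proj, h.2]
  ext i
  fin_cases i <;> rfl

theorem proj_mem_quantumSolutions (hħ : ħ ≠ 0) {q : quadraticDifferentials C} {U : Opens C}
    {Ψ : (x : U) → (P.E ħ).Fiber x} (hΨ : Ψ ∈ P.flatSections q ħ U) :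
    (fun x : U => P.proj (Ψ x)) ∈ P.quantumSolutions q ħ U := by
  refine ⟨fun α => ?_, fun α x hx => ?_⟩
  · rw [comp_ext0_proj]
    exact contMDiffOn_pi_space.1 (hΨ.1 α) 1
  · have hflat : ∀ y ∈ U ⊓ P.dom α, _ := fun y hy =>
      (P.hbarConn_eq_zero_iff q hy.2 (mdifferentiableAt_comp _ hΨ.1 hy.1 hy.2)).1 (hΨ.2 y hy.1)
    have hev : dz (P.chart α) (fun y => comp (P.E ħ) α (ext0 Ψ) y 1) =ᶠ[𝓝 x]
        fun y => ħ⁻¹ * comp (P.E ħ) α (ext0 Ψ) y 0 := by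
      filter_upwards [(U ⊓ P.dom α).isOpen.mem_nhds hx] with y hy
      rw [← (hflat y hy).2, inv_mul_cancel_left₀ hħ]
    have hd := hasDerivAt_pi.1 (hasDerivAt_comp_symm (P.mem_maximalAtlas α) hx.2
      (mdifferentiableAt_comp _ hΨ.1 hx.1 hx.2)) 0
    have h0 := dz_eq_of_hasDerivAt (f := fun y => comp (P.E ħ) α (ext0 Ψ) y 0)
      (P.mem_maximalAtlas α) hx.2 hd
    rw [quantumOp, comp_ext0_proj, dz_congr hev, dz_eq_of_hasDerivAt
      (f := fun y => ħ⁻¹ * comp (P.E ħ) α (ext0 Ψ) y 0) (P.mem_maximalAtlas α) hx.2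
      (hd.const_mul ħ⁻¹), ← h0, ← (hflat x hx).1]
    field_simp
    ring

/-- The section `(ħ ψ', ψ)` of `E_ħ` for a section `ψ` of `K^{-1/2}`. -/
noncomputable def jet (ħ : ℂ) {U : Opens C} (ψ : (x : U) → P.invHalf.Fiber x) (x : U) :
    (P.E ħ).Fiber x :=
  (![ħ * dz (P.chart (P.idx x)) (comp P.invHalf (P.idx x) (ext0 ψ)) x, (ψ x : ℂ)] :)

theorem comp_ext0_jet {U : Opens C} {ψ : (x : U) → P.invHalf.Fiber x}
    (hψ : ψ ∈ holSections P.invHalf U) (hU : x ∈ U) (hα : x ∈ (P.chart α).source) :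
    comp (P.E ħ) α (ext0 (P.jet ħ ψ)) x =
      ![ħ * dz (P.chart α) (comp P.invHalf α (ext0 ψ)) x, comp P.invHalf α (ext0 ψ) x] := by
  have hβ := P.mem_idx x
  rw [P.dz_comp_invHalf_change hα hβ (mdifferentiableAt_comp _ hψ hU hβ),
    P.comp_invHalf_change hα hβ, P.comp_invHalf_idx]
  refine (congrArg ((P.E ħ).coordChange (P.idx x) α x) (ext0_of_mem _ hU)).trans ?_
  refine (P.g_mulVec ħ α (P.idx x) x _).trans ?_
  rw [ext0_of_mem _ hU]
  set D := dz (P.chart (P.idx x)) (comp P.invHalf (P.idx x) (ext0 ψ)) x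
  let c : ℂ := ψ ⟨x, hU⟩
  change ![P.ξ α (P.idx x) x * (ħ * D) - ħ * P.f α (P.idx x) 1 0 * c, (P.ξ α (P.idx x) x)⁻¹ * c]
    = ![ħ * (P.ξ α (P.idx x) x * D - P.f α (P.idx x) 1 0 * c), (P.ξ α (P.idx x) x)⁻¹ * c]
  congr 1
  ring

theorem jet_mem_flatSections {q : quadraticDifferentials C} {U : Opens C}
    {ψ : (x : U) → P.invHalf.Fiber x} (hψ : ψ ∈ P.quantumSolutions q ħ U) :
    P.jet ħ ψ ∈ P.flatSections q ħ U := by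
  have hev : ∀ α, ∀ x ∈ U ⊓ P.dom α, comp (P.E ħ) α (ext0 (P.jet ħ ψ)) =ᶠ[𝓝 x] fun y =>
      ![ħ * dz (P.chart α) (comp P.invHalf α (ext0 ψ)) y, comp P.invHalf α (ext0 ψ) y] := by
    intro α x hx
    filter_upwards [(U ⊓ P.dom α).isOpen.mem_nhds hx] with y hy
    exact P.comp_ext0_jet hψ.1 hy.1 hy.2
  have hhol : P.jet ħ ψ ∈ holSections (P.E ħ) U := by
    intro α x hx
    refine ContMDiffAt.contMDiffWithinAt (ContMDiffAt.congr_of_eventuallyEq ?_ (hev α x hx))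
    have h := contMDiffAt_comp _ hψ.1 hx.1 hx.2
    refine contMDiffAt_pi_space.2 fun i => ?_
    fin_cases i
    · exact contMDiffAt_const.mul (contMDiffAt_dz (P.mem_maximalAtlas α) hx.2 h)
    · exact h
  refine ⟨hhol, fun x hU => ?_⟩
  have hα := P.mem_idx x
  set α := P.idx x
  have he := hev α x ⟨hU, hα⟩
  refine (P.hbarConn_eq_zero_iff q hα (mdifferentiableAt_comp _ hhol hU hα)).2 ?_
  have h0 : (fun y => comp (P.E ħ) α (ext0 (P.jet ħ ψ)) y 0) =ᶠ[𝓝 x] fun y =>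
      ħ * dz (P.chart α) (comp P.invHalf α (ext0 ψ)) y := he.fun_comp (fun w => w 0)
  have h1 : (fun y => comp (P.E ħ) α (ext0 (P.jet ħ ψ)) y 1) =ᶠ[𝓝 x]
      comp P.invHalf α (ext0 ψ) := he.fun_comp (fun w => w 1)
  have hd := (hasDerivAt_dz (P.mem_maximalAtlas α) hα ((contMDiffAt_dz (P.mem_maximalAtlas α) hα
    (contMDiffAt_comp _ hψ.1 hU hα)).mdifferentiableAt (by simp))).const_mul ħ
  have hq := hψ.2 α x ⟨hU, hα⟩
  rw [quantumOp] at hq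
  rw [dz_congr h0, dz_congr h1, he.self_of_nhds, dz_eq_of_hasDerivAt
    (f := fun y => ħ * dz (P.chart α) (comp P.invHalf α (ext0 ψ)) y)
    (P.mem_maximalAtlas α) hα hd]
  refine ⟨?_, rfl⟩
  simp only [Matrix.cons_val_one, Matrix.cons_val_fin_one]
  linear_combination hq

theorem bijOn_proj (hħ : ħ ≠ 0) (q : quadraticDifferentials C) (U : Opens C) :
    Set.BijOn (fun Ψ (x : U) => P.proj (Ψ x)) (P.flatSections q ħ U)
      (P.quantumSolutions q ħ U) := by
  refine ⟨fun Ψ hΨ => P.proj_mem_quantumSolutions hħ hΨ, fun Ψ hΨ Ψ' hΨ' h => ?_, fun ψ hψ =>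
    ⟨P.jet ħ ψ, P.jet_mem_flatSections hψ, funext fun x => rfl⟩⟩
  funext x
  have h1 := P.comp_ext0_eq_of_mem_flatSections hΨ x.2 (P.mem_idx x)
  have h2 := P.comp_ext0_eq_of_mem_flatSections hΨ' x.2 (P.mem_idx x)
  simp only at h
  rw [h, ← h2, P.comp_E_idx, P.comp_E_idx, ext0_of_mem _ x.2, ext0_of_mem _ x.2] at h1
  exact h1

end ProjectiveCoordinates

end OperSCL

namespace OperSCL

namespace ProjectiveCoordinates

variable {C ι : Type*} [TopologicalSpace C] [ChartedSpace ℂ C] [IsManifold 𝓘(ℂ, ℂ) ω C]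
  (P : ProjectiveCoordinates C ι) {α β : ι} {x : C} {ħ : ℂ} {U : Opens C}

/-! ### Holomorphic functions and the derivation `d/dz` -/

theorem contMDiffAt_ext0 (a : Hol U) (hx : x ∈ U) :
    ContMDiffAt 𝓘(ℂ, ℂ) 𝓘(ℂ, ℂ) ω (ext0 (V := fun _ => ℂ) a) x := by
  refine contMDiffAt_subtype_iff (x := ⟨x, hx⟩).1 ?_
  refine (a.contMDiff ⟨x, hx⟩).congr_of_eventuallyEq (Filter.Eventually.of_forall fun y => ?_)
  simp [ext0]

theorem hasDerivAt_ext0 (hU : U ≤ P.dom α) (a : Hol U) (x : U) :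
    HasDerivAt (ext0 (V := fun _ => ℂ) a ∘ (P.chart α).symm) (P.ddz hU a x)
      (P.chart α x) :=
  hasDerivAt_dz (P.mem_maximalAtlas α) (hU x.2)
    ((contMDiffAt_ext0 a x.2).mdifferentiableAt (by simp))

theorem ddz_eq (hU : U ≤ P.dom α) (a : Hol U) (x : U) {d : ℂ}
    (h : HasDerivAt (ext0 (V := fun _ => ℂ) a ∘ (P.chart α).symm) d (P.chart α x)) :
    P.ddz hU a x = d :=
  (P.hasDerivAt_ext0 hU a x).unique h

theorem ext0_coe (a : Hol U) (x : U) : ext0 (V := fun _ => ℂ) a (x : C) = a x :=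
  ext0_of_mem _ x.2

theorem ddz_add (hU : U ≤ P.dom α) (a b : Hol U) :
    P.ddz hU (a + b) = P.ddz hU a + P.ddz hU b := by
  ext x
  refine P.ddz_eq hU _ x (((P.hasDerivAt_ext0 hU a x).add
    (P.hasDerivAt_ext0 hU b x)).congr_of_eventuallyEq ?_)
  refine Filter.Eventually.of_forall fun y => ?_
  by_cases h : (P.chart α).symm y ∈ U <;> simp [ext0, h]

theorem ddz_mul (hU : U ≤ P.dom α) (a b : Hol U) :
    P.ddz hU (a * b) = P.ddz hU a * b + a * P.ddz hU b := by
  ext x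
  refine P.ddz_eq hU _ x ((((P.hasDerivAt_ext0 hU a x).mul
    (P.hasDerivAt_ext0 hU b x)).congr_of_eventuallyEq ?_).congr_deriv ?_)
  · refine Filter.Eventually.of_forall fun y => ?_
    by_cases h : (P.chart α).symm y ∈ U <;> simp [ext0, h]
  · simp [(P.chart α).left_inv (hU x.2), ext0_coe]

theorem ddz_smul (hU : U ≤ P.dom α) (k : ℂ) (a : Hol U) :
    P.ddz hU (k • a) = k • P.ddz hU a := by
  ext x
  refine P.ddz_eq hU _ x (((P.hasDerivAt_ext0 hU a x).const_smul k).congr_of_eventuallyEq ?_)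
  refine Filter.Eventually.of_forall fun y => ?_
  by_cases h : (P.chart α).symm y ∈ U <;> simp [ext0, h]

theorem ddz_one (hU : U ≤ P.dom α) : P.ddz hU (1 : Hol U) = 0 := by
  have h := P.ddz_mul hU 1 1
  rw [mul_one, mul_one, one_mul] at h
  exact (add_eq_left.1 h.symm)

theorem ddz_zero (hU : U ≤ P.dom α) : P.ddz hU (0 : Hol U) = 0 := by
  simpa using P.ddz_smul hU 0 0

/-! ### Sections in the frame over a coordinate neighbourhood -/

theorem contMDiffAt_ξ (α : ι) (hβ : x ∈ (P.chart β).source) :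
    ContMDiffAt 𝓘(ℂ, ℂ) 𝓘(ℂ, ℂ) ω (P.ξ α β) x :=
  (contMDiffAt_const.mul (contMDiffAt_of_mem_maximalAtlas (P.mem_maximalAtlas β) hβ)).add
    contMDiffAt_const

theorem mem_holSections_of_comp (hU : U ≤ P.dom α) {s : (x : U) → (P.E ħ).Fiber x}
    (hs : ∀ x ∈ U, ContMDiffAt 𝓘(ℂ, ℂ) 𝓘(ℂ, Fin 2 → ℂ) ω (comp (P.E ħ) α (ext0 s)) x) :
    s ∈ holSections (P.E ħ) U := by
  intro β x hx
  have hα : x ∈ (P.chart α).source := hU hx.1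
  have hev : comp (P.E ħ) β (ext0 s) =ᶠ[𝓝 x] fun y =>
      ![P.ξ β α y * comp (P.E ħ) α (ext0 s) y 0
          - ħ * P.f β α 1 0 * comp (P.E ħ) α (ext0 s) y 1,
        (P.ξ β α y)⁻¹ * comp (P.E ħ) α (ext0 s) y 1] := by
    filter_upwards [(P.chart α).open_source.mem_nhds hα,
      (P.chart β).open_source.mem_nhds hx.2] with y hyα hyβ
    rw [P.comp_E_change hyα hyβ, g_mulVec]
  refine ContMDiffAt.contMDiffWithinAt (ContMDiffAt.congr_of_eventuallyEq ?_ hev)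
  have h := contMDiffAt_pi_space.1 (hs x hx.1)
  have hξ := P.contMDiffAt_ξ β hα
  have hξi : ContMDiffAt 𝓘(ℂ, ℂ) 𝓘(ℂ, ℂ) ω (fun y => (P.ξ β α y)⁻¹) x :=
    ((contDiffAt_inv ℂ (P.ξ_ne hx.2 hα)).contMDiffAt).comp x hξ
  refine contMDiffAt_pi_space.2 fun i => ?_
  fin_cases i
  · exact (hξ.mul (h 0)).sub (contMDiffAt_const.mul (h 1))
  · exact hξi.mul (h 1)

theorem coordChange_injective (ħ : ℂ) (hα : x ∈ (P.chart α).source) {w w' : (P.E ħ).Fiber x}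
    (h : (P.E ħ).coordChange (P.idx x) α x w = (P.E ħ).coordChange (P.idx x) α x w') :
    w = w' :=
  (P.g_mulVec_cancel ħ (P.mem_idx x) hα w).symm.trans
    ((congrArg _ h).trans (P.g_mulVec_cancel ħ (P.mem_idx x) hα w'))

/-- The section of `E_ħ` with given components in the frame over `U_α`. -/
noncomputable def frameSection (ħ : ℂ) (hU : U ≤ P.dom α) (a : Hol U × Hol U) :
    holSections (P.E ħ) U :=
  ⟨fun x => (P.E ħ).coordChange α (P.idx x) x ![a.1 x, a.2 x], P.mem_holSections_of_comp hU (by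
    intro x hx
    have hev : comp (P.E ħ) α (ext0 (V := (P.E ħ).Fiber) fun x : U =>
        (P.E ħ).coordChange α (P.idx x) x ![a.1 x, a.2 x]) =ᶠ[𝓝 x] fun y =>
          ![ext0 (V := fun _ => ℂ) a.1 y, ext0 (V := fun _ => ℂ) a.2 y] := by
      filter_upwards [U.isOpen.mem_nhds hx] with y hy
      refine (congrArg ((P.E ħ).coordChange (P.idx y) α y) (ext0_of_mem _ hy)).trans ?_
      rw [ext0_of_mem _ hy, ext0_of_mem _ hy]
      exact P.g_mulVec_cancel ħ (hU hy) (P.mem_idx y) _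
    refine ContMDiffAt.congr_of_eventuallyEq ?_ hev
    refine contMDiffAt_pi_space.2 fun i => ?_
    fin_cases i
    · exact contMDiffAt_ext0 a.1 hx
    · exact contMDiffAt_ext0 a.2 hx)⟩

theorem coordChange_frameSection (hU : U ≤ P.dom α) (a : Hol U × Hol U) (x : U) :
    (P.E ħ).coordChange (P.idx x) α x ((P.frameSection ħ hU a).1 x) = ![a.1 x, a.2 x] :=
  P.g_mulVec_cancel ħ (hU x.2) (P.mem_idx x) _

theorem comp_frameSection (hU : U ≤ P.dom α) (a : Hol U × Hol U) (hx : x ∈ U) :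
    comp (P.E ħ) α (ext0 (P.frameSection ħ hU a).1) x
      = ![ext0 (V := fun _ => ℂ) a.1 x, ext0 (V := fun _ => ℂ) a.2 x] := by
  refine (congrArg ((P.E ħ).coordChange (P.idx x) α x) (ext0_of_mem _ hx)).trans ?_
  rw [ext0_of_mem _ hx, ext0_of_mem _ hx]
  exact P.coordChange_frameSection hU a ⟨x, hx⟩

/-- A component of a section of `E_ħ` in the frame over `U_α`. -/
noncomputable def component (hU : U ≤ P.dom α) (s : holSections (P.E ħ) U) (i : Fin 2) :
    Hol U where
  val x := (P.E ħ).coordChange (P.idx x) α x (s.1 x) i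
  property x := by
    have h : ContMDiffAt 𝓘(ℂ, ℂ) 𝓘(ℂ, ℂ) ω
        (fun y : U => comp (P.E ħ) α (ext0 s.1) (y : C) i) x :=
      contMDiffAt_subtype_iff.2
        (contMDiffAt_pi_space.1 (contMDiffAt_comp _ s.2 x.2 (hU x.2)) i)
    refine h.congr_of_eventuallyEq (Filter.Eventually.of_forall fun y => ?_)
    exact congrFun (congrArg ((P.E ħ).coordChange (P.idx y) α y)
      (ext0_of_mem s.1 y.2).symm) i

/-- Over `U ⊆ U_α` the bundle `E_ħ` is trivialized by its frame. -/
noncomputable def frameEquiv (ħ : ℂ) (hU : U ≤ P.dom α) :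
    (Hol U × Hol U) ≃ₗ[ℂ] holSections (P.E ħ) U where
  toFun := P.frameSection ħ hU
  invFun s := (P.component hU s 0, P.component hU s 1)
  map_add' a b := by
    refine Subtype.ext (funext fun x => ?_)
    refine Eq.trans ?_ (((P.E ħ).coordChange α (P.idx x) x).map_add
      ![a.1 x, a.2 x] ![b.1 x, b.2 x])
    refine congrArg ((P.E ħ).coordChange α (P.idx x) x) ?_
    ext i
    fin_cases i <;> rfl
  map_smul' k a := by
    refine Subtype.ext (funext fun x => ?_)
    refine Eq.trans ?_ (((P.E ħ).coordChange α (P.idx x) x).map_smul k ![a.1 x, a.2 x])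
    refine congrArg ((P.E ħ).coordChange α (P.idx x) x) ?_
    ext i
    fin_cases i <;> rfl
  left_inv a := by
    refine Prod.ext ?_ ?_
    · ext x
      exact congrFun (P.coordChange_frameSection hU a x) 0
    · ext x
      exact congrFun (P.coordChange_frameSection hU a x) 1
  right_inv s := by
    refine Subtype.ext (funext fun x => ?_)
    refine P.coordChange_injective ħ (hU x.2) ((P.coordChange_frameSection hU _ x).trans ?_)
    ext i
    fin_cases i <;> rfl

theorem frameSection_smul (hU : U ≤ P.dom α) (f : Hol U) (a : Hol U × Hol U) (x : U) :
    (P.frameSection ħ hU (f * a.1, f * a.2)).1 x = f x • (P.frameSection ħ hU a).1 x := by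
  refine Eq.trans ?_ (((P.E ħ).coordChange α (P.idx x) x).map_smul (f x) ![a.1 x, a.2 x])
  refine congrArg ((P.E ħ).coordChange α (P.idx x) x) ?_
  ext i
  fin_cases i <;> rfl

theorem hbarConn_frameSection (hħ : ħ ≠ 0) (q : quadraticDifferentials C) (hU : U ≤ P.dom α)
    (a : Hol U × Hol U) (x : U) :
    ħ • (P.frameSection ħ hU (P.ddz hU a.1 - ħ⁻¹ • (P.coeffHol q hU * a.2),
        P.ddz hU a.2 - ħ⁻¹ • a.1)).1 x
      = P.hbarConn q ħ (ext0 (P.frameSection ħ hU a).1) x (coordVec (P.chart α) x) := by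
  refine P.coordChange_injective ħ (hU x.2) ?_
  refine (((P.E ħ).coordChange (P.idx x) α x).map_smul ħ _).trans ?_
  rw [coordChange_frameSection]
  refine Eq.trans ?_ (P.hbarConn_coordVec q (hU x.2)
    (mdifferentiableAt_comp _ (P.frameSection ħ hU a).2 x.2 (hU x.2))).symm
  have hev : comp (P.E ħ) α (ext0 (P.frameSection ħ hU a).1) =ᶠ[𝓝 (x : C)] fun y =>
      ![ext0 (V := fun _ => ℂ) a.1 y, ext0 (V := fun _ => ℂ) a.2 y] := by
    filter_upwards [U.isOpen.mem_nhds x.2] with y hy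
    exact P.comp_frameSection hU a hy
  have h0 : (fun y => comp (P.E ħ) α (ext0 (P.frameSection ħ hU a).1) y 0) =ᶠ[𝓝 (x : C)]
      ext0 (V := fun _ => ℂ) a.1 := hev.fun_comp (fun w => w 0)
  have h1 : (fun y => comp (P.E ħ) α (ext0 (P.frameSection ħ hU a).1) y 1) =ᶠ[𝓝 (x : C)]
      ext0 (V := fun _ => ℂ) a.2 := hev.fun_comp (fun w => w 1)
  have hx : comp (P.E ħ) α (ext0 (P.frameSection ħ hU a).1) x = ![a.1 x, a.2 x] := by
    rw [P.comp_frameSection hU a x.2, ext0_coe, ext0_coe]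
  have hq : P.coeffHol q hU x = coeff q (P.chart α) x := rfl
  have hd : ∀ f : Hol U, dz (P.chart α) (ext0 (V := fun _ => ℂ) f) x = P.ddz hU f x :=
    fun f => rfl
  rw [dz_congr h0, dz_congr h1, hx, hd, hd]
  ext i
  fin_cases i
  · simp [hq]
    field_simp
  · simp
    field_simp

/-! ### The D-module of the ħ-connection -/

/-- The operator `∂` on the sections of `E_ħ`, in the frame over `U_α`. -/
noncomputable def frameDel (q : quadraticDifferentials C) (ħ : ℂ) (hU : U ≤ P.dom α) :
    Module.End ℂ (Hol U × Hol U) where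
  toFun a := (P.ddz hU a.1 - ħ⁻¹ • (P.coeffHol q hU * a.2), P.ddz hU a.2 - ħ⁻¹ • a.1)
  map_add' a b := by
    refine Prod.ext ?_ ?_
    · simp only [Prod.fst_add, Prod.snd_add, ddz_add, mul_add, smul_add]
      abel
    · simp only [Prod.fst_add, Prod.snd_add, ddz_add, smul_add]
      abel
  map_smul' k a := by
    refine Prod.ext ?_ ?_
    · simp only [Prod.smul_fst, Prod.smul_snd, ddz_smul, mul_smul_comm, smul_sub,
        RingHom.id_apply, smul_comm k]
    · simp only [Prod.smul_fst, Prod.smul_snd, ddz_smul, smul_sub, RingHom.id_apply, smul_comm k]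

/-- The action of differential operators on the sections of `E_ħ`, in the frame over `U_α`. -/
noncomputable def frameAction (q : quadraticDifferentials C) (ħ : ℂ) (hU : U ≤ P.dom α) :
    P.DiffOp hU →ₐ[ℂ] Module.End ℂ (Hol U × Hol U) :=
  RingQuot.liftAlgHom ℂ ⟨FreeAlgebra.lift ℂ (Sum.elim
    (fun a => (LinearMap.mulLeft ℂ a).prodMap (LinearMap.mulLeft ℂ a))
    fun _ => P.frameDel q ħ hU), by
      intro s t h
      induction h with
      | add a b =>
        refine LinearMap.ext fun c => ?_
        simp [add_mul]
      | mul a b =>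
        refine LinearMap.ext fun c => ?_
        simp
      | const k =>
        refine LinearMap.ext fun c => ?_
        simp [Algebra.algebraMap_eq_smul_one, Prod.ext_iff]
      | leibniz a =>
        refine LinearMap.ext fun c => ?_
        refine Prod.ext ?_ ?_
        · simp [frameDel, ddz_mul, mul_sub, mul_left_comm]
          abel
        · simp [frameDel, ddz_mul, mul_sub]
          abel⟩

theorem frameAction_fn (q : quadraticDifferentials C) (ħ : ℂ) (hU : U ≤ P.dom α) (f : Hol U)
    (a : Hol U × Hol U) : P.frameAction q ħ hU (P.fn hU f) a = (f * a.1, f * a.2) := by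
  simp [frameAction, fn]

theorem frameAction_del (q : quadraticDifferentials C) (ħ : ℂ) (hU : U ≤ P.dom α)
    (a : Hol U × Hol U) : P.frameAction q ħ hU (P.del hU) a
      = (P.ddz hU a.1 - ħ⁻¹ • (P.coeffHol q hU * a.2), P.ddz hU a.2 - ħ⁻¹ • a.1) := by
  simp [frameAction, del, frameDel]

/-- The D-module structure on the sections of `E_ħ` given by the ħ-connection. -/
noncomputable def sectionAction (q : quadraticDifferentials C) (ħ : ℂ) (hU : U ≤ P.dom α) :
    P.DiffOp hU →ₐ[ℂ] Module.End ℂ (holSections (P.E ħ) U) :=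
  ((P.frameEquiv ħ hU).conjAlgEquiv ℂ).toAlgHom.comp (P.frameAction q ħ hU)

theorem sectionAction_frameSection (q : quadraticDifferentials C) (ħ : ℂ) (hU : U ≤ P.dom α)
    (T : P.DiffOp hU) (a : Hol U × Hol U) :
    P.sectionAction q ħ hU T (P.frameSection ħ hU a)
      = P.frameSection ħ hU (P.frameAction q ħ hU T a) := by
  change P.frameEquiv ħ hU (P.frameAction q ħ hU T
    ((P.frameEquiv ħ hU).symm (P.frameEquiv ħ hU a))) = _
  rw [LinearEquiv.symm_apply_apply]
  rfl

theorem exists_frameSection_eq (hU : U ≤ P.dom α) (s : holSections (P.E ħ) U) :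
    ∃ a, P.frameSection ħ hU a = s :=
  (P.frameEquiv ħ hU).surjective s

theorem isDModuleAction_sectionAction (hħ : ħ ≠ 0) (q : quadraticDifferentials C)
    (hU : U ≤ P.dom α) : P.IsDModuleAction q ħ hU (P.sectionAction q ħ hU) := by
  refine ⟨fun f s x => ?_, fun s x => ?_⟩
  · obtain ⟨a, rfl⟩ := P.exists_frameSection_eq hU s
    rw [sectionAction_frameSection, frameAction_fn, frameSection_smul]
  · obtain ⟨a, rfl⟩ := P.exists_frameSection_eq hU s
    rw [sectionAction_frameSection, frameAction_del]
    exact P.hbarConn_frameSection hħ q hU a x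

theorem diffOp_hom_ext (hU : U ≤ P.dom α) {A : Type*} [Semiring A] [Algebra ℂ A]
    {ρ ρ' : P.DiffOp hU →ₐ[ℂ] A} (hf : ∀ a, ρ (P.fn hU a) = ρ' (P.fn hU a))
    (hd : ρ (P.del hU) = ρ' (P.del hU)) : ρ = ρ' := by
  refine RingQuot.ringQuot_ext' _ _ _ (FreeAlgebra.hom_ext (funext fun i => ?_))
  rcases i with a | ⟨⟩
  · exact hf a
  · exact hd

theorem IsDModuleAction.eq {q : quadraticDifferentials C} (hħ : ħ ≠ 0) {hU : U ≤ P.dom α}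
    {ρ ρ' : P.DiffOp hU →ₐ[ℂ] Module.End ℂ (holSections (P.E ħ) U)}
    (h : P.IsDModuleAction q ħ hU ρ) (h' : P.IsDModuleAction q ħ hU ρ') : ρ = ρ' := by
  refine P.diffOp_hom_ext hU (fun a => ?_) ?_
  · exact LinearMap.ext fun s => Subtype.ext (funext fun x =>
      (h.1 a s x).trans (h'.1 a s x).symm)
  · exact LinearMap.ext fun s => Subtype.ext (funext fun x =>
      smul_right_injective _ hħ ((h.2 s x).trans (h'.2 s x).symm))

/-! ### Normal forms of differential operators modulo the quantum curve -/

theorem fn_add (hU : U ≤ P.dom α) (a b : Hol U) :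
    P.fn hU (a + b) = P.fn hU a + P.fn hU b := by
  simpa [fn] using RingQuot.mkAlgHom_rel ℂ (DiffRel.add (P := P) (hU := hU) a b)

theorem fn_mul (hU : U ≤ P.dom α) (a b : Hol U) :
    P.fn hU (a * b) = P.fn hU a * P.fn hU b := by
  simpa [fn] using RingQuot.mkAlgHom_rel ℂ (DiffRel.mul (P := P) (hU := hU) a b)

theorem fn_algebraMap (hU : U ≤ P.dom α) (k : ℂ) :
    P.fn hU (algebraMap ℂ (Hol U) k) = algebraMap ℂ _ k := by
  simpa [fn] using RingQuot.mkAlgHom_rel ℂ (DiffRel.const (P := P) (hU := hU) k)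

theorem del_mul_fn (hU : U ≤ P.dom α) (a : Hol U) :
    P.del hU * P.fn hU a = P.fn hU a * P.del hU + P.fn hU (P.ddz hU a) := by
  simpa [fn, del] using RingQuot.mkAlgHom_rel ℂ (DiffRel.leibniz (P := P) (hU := hU) a)

theorem fn_one (hU : U ≤ P.dom α) : P.fn hU 1 = 1 := by
  simpa using P.fn_algebraMap hU 1

theorem fn_zero (hU : U ≤ P.dom α) : P.fn hU 0 = 0 := by
  simpa using P.fn_algebraMap hU 0

theorem fn_smul (hU : U ≤ P.dom α) (k : ℂ) (a : Hol U) : P.fn hU (k • a) = k • P.fn hU a := by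
  rw [Algebra.smul_def, fn_mul, fn_algebraMap, ← Algebra.smul_def]

theorem diffOp_induction (hU : U ≤ P.dom α) {p : P.DiffOp hU → Prop} (h1 : p 1)
    (hadd : ∀ S T, p S → p T → p (S + T)) (hfn : ∀ a T, p T → p (P.fn hU a * T))
    (hdel : ∀ T, p T → p (P.del hU * T)) (T : P.DiffOp hU) : p T := by
  obtain ⟨t, rfl⟩ := RingQuot.mkAlgHom_surjective ℂ (P.DiffRel hU) T
  suffices h : ∀ S, p S → p (RingQuot.mkAlgHom ℂ (P.DiffRel hU) t * S) by
    simpa using h 1 h1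
  induction t using FreeAlgebra.induction with
  | grade0 k =>
    intro S hS
    rw [AlgHom.commutes, ← P.fn_algebraMap hU]
    exact hfn _ _ hS
  | grade1 i =>
    intro S hS
    rcases i with a | ⟨⟩
    · exact hfn a S hS
    · exact hdel S hS
  | mul s t hs ht =>
    intro S hS
    rw [map_mul, mul_assoc]
    exact hs _ (ht _ hS)
  | add s t hs ht =>
    intro S hS
    rw [map_add, add_mul]
    exact hadd _ _ (hs _ hS) (ht _ hS)

theorem del_mul_del_sub_mem (hħ : ħ ≠ 0) (q : quadraticDifferentials C) (hU : U ≤ P.dom α) :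
    P.del hU * P.del hU - P.fn hU ((ħ ^ 2)⁻¹ • P.coeffHol q hU)
      ∈ Submodule.span (P.DiffOp hU) {P.quantumElt q ħ hU} := by
  have h : P.del hU * P.del hU - P.fn hU ((ħ ^ 2)⁻¹ • P.coeffHol q hU)
      = algebraMap ℂ (P.DiffOp hU) (ħ ^ 2)⁻¹ • P.quantumElt q ħ hU := by
    rw [smul_eq_mul, ← Algebra.smul_def, quantumElt, smul_sub, smul_smul,
      inv_mul_cancel₀ (pow_ne_zero 2 hħ), one_smul, ← fn_smul, pow_two (P.del hU)]
  rw [h]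
  exact Submodule.smul_mem _ _ (Submodule.mem_span_singleton_self _)

/-- Every differential operator is congruent to one of order at most one modulo the left ideal
of the quantum curve. -/
theorem exists_normalForm (hħ : ħ ≠ 0) (q : quadraticDifferentials C) (hU : U ≤ P.dom α)
    (T : P.DiffOp hU) : ∃ a b : Hol U, T - (P.fn hU a + P.fn hU b * P.del hU)
      ∈ Submodule.span (P.DiffOp hU) {P.quantumElt q ħ hU} := by
  induction T using P.diffOp_induction hU with
  | h1 => exact ⟨1, 0, by simp [fn_one, fn_zero]⟩
  | hadd S T hS hT =>
    obtain ⟨a, b, h⟩ := hS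
    obtain ⟨c, d, h'⟩ := hT
    refine ⟨a + c, b + d, ?_⟩
    convert add_mem h h' using 1
    rw [fn_add, fn_add, add_mul]
    abel
  | hfn f T hT =>
    obtain ⟨a, b, h⟩ := hT
    refine ⟨f * a, f * b, ?_⟩
    convert Submodule.smul_mem _ (P.fn hU f) h using 1
    rw [fn_mul, fn_mul, smul_eq_mul, mul_sub, mul_add, mul_assoc]
  | hdel T hT =>
    obtain ⟨a, b, h⟩ := hT
    refine ⟨P.ddz hU a + b * ((ħ ^ 2)⁻¹ • P.coeffHol q hU), a + P.ddz hU b, ?_⟩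
    convert add_mem (Submodule.smul_mem _ (P.del hU) h)
      (Submodule.smul_mem _ (P.fn hU b) (P.del_mul_del_sub_mem hħ q hU)) using 1
    rw [smul_eq_mul, smul_eq_mul, mul_sub, mul_add, ← mul_assoc, del_mul_fn, del_mul_fn,
      fn_add, fn_add, fn_mul]
    simp only [mul_sub, add_mul, mul_assoc]
    abel

theorem frameAction_quantumElt (hħ : ħ ≠ 0) (q : quadraticDifferentials C) (hU : U ≤ P.dom α) :
    P.frameAction q ħ hU (P.quantumElt q ħ hU) (1, 0) = 0 := by
  rw [quantumElt, map_sub, map_smul, map_pow, pow_two (P.frameAction q ħ hU _), LinearMap.sub_apply, LinearMap.smul_apply,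
    Module.End.mul_apply, frameAction_fn, frameAction_del, frameAction_del]
  refine Prod.ext ?_ ?_
  · simp [ddz_one, ddz_zero, smul_smul]
    field_simp
    simp
  · simp only [ddz_one, ddz_zero, mul_zero, smul_zero, sub_zero, zero_sub]
    have h : P.ddz hU (-(ħ⁻¹ • (1 : Hol U))) = 0 := by
      rw [← neg_smul, ddz_smul, ddz_one, smul_zero]
    simp [h]

theorem frameAction_normalForm (q : quadraticDifferentials C) (hU : U ≤ P.dom α) (a b : Hol U) :
    P.frameAction q ħ hU (P.fn hU a + P.fn hU b * P.del hU) (1, 0) = (a, -(ħ⁻¹ • b)) := by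
  rw [map_add, map_mul, LinearMap.add_apply, Module.End.mul_apply, frameAction_del,
    frameAction_fn, frameAction_fn]
  simp [ddz_one, ddz_zero]

/-- The D-module of the ħ-connection is the D-module of the quantum curve. -/
theorem exists_quantumModule_equiv (hħ : ħ ≠ 0) (q : quadraticDifferentials C)
    (hU : U ≤ P.dom α) :
    ∃ Φ : P.QuantumModule q ħ hU ≃+ holSections (P.E ħ) U,
      (∀ T y, Φ (T • y) = P.sectionAction q ħ hU T (Φ y)) ∧
      Φ (Submodule.Quotient.mk 1) = P.frameSection ħ hU (1, 0) := by
  let : Module (P.DiffOp hU) (Hol U × Hol U) :=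
    Module.compHom _ (P.frameAction q ħ hU).toRingHom
  have hsmul : ∀ (T : P.DiffOp hU) (a : Hol U × Hol U), T • a = P.frameAction q ħ hU T a :=
    fun T a => rfl
  set I := Submodule.span (P.DiffOp hU) {P.quantumElt q ħ hU}
  let L : P.DiffOp hU →ₗ[P.DiffOp hU] Hol U × Hol U :=
    LinearMap.toSpanSingleton (P.DiffOp hU) _ ((1, 0) : Hol U × Hol U)
  have hL : ∀ T, L T = P.frameAction q ħ hU T (1, 0) := fun T => rfl
  have hI : I ≤ LinearMap.ker L := by
    refine Submodule.span_le.2 (Set.singleton_subset_iff.2 ?_)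
    exact P.frameAction_quantumElt hħ q hU
  have hker : LinearMap.ker L ≤ I := by
    intro T hT
    obtain ⟨a, b, h⟩ := P.exists_normalForm hħ q hU T
    have h1 : L (P.fn hU a + P.fn hU b * P.del hU) = 0 := by
      have h2 := hI h
      rw [LinearMap.mem_ker, map_sub, LinearMap.mem_ker.1 hT, zero_sub, neg_eq_zero] at h2
      exact h2
    rw [hL, frameAction_normalForm] at h1
    obtain ⟨rfl, hb⟩ := Prod.mk.inj h1
    rw [neg_eq_zero, smul_eq_zero_iff_right (inv_ne_zero hħ)] at hb
    subst hb
    simpa [fn_zero] using h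
  have hsurj : Function.Surjective L := fun a => by
    refine ⟨P.fn hU a.1 + P.fn hU (-(ħ • a.2)) * P.del hU, ?_⟩
    rw [hL, frameAction_normalForm, smul_neg, neg_neg, smul_smul, inv_mul_cancel₀ hħ, one_smul]
  let Φ₀ : P.QuantumModule q ħ hU →ₗ[P.DiffOp hU] Hol U × Hol U := I.liftQ L hI
  have hbij : Function.Bijective Φ₀ := by
    refine ⟨LinearMap.ker_eq_bot.1 (Submodule.ker_liftQ_eq_bot _ _ _ hker), fun a => ?_⟩
    obtain ⟨T, rfl⟩ := hsurj a
    exact ⟨Submodule.Quotient.mk T, rfl⟩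
  refine ⟨(LinearEquiv.ofBijective Φ₀ hbij).toAddEquiv.trans (P.frameEquiv ħ hU).toAddEquiv,
    fun T y => ?_, ?_⟩
  · change P.frameSection ħ hU (Φ₀ (T • y)) = P.sectionAction q ħ hU T
      (P.frameSection ħ hU (Φ₀ y))
    rw [sectionAction_frameSection, map_smul, hsmul]
  · change P.frameSection ħ hU (L 1) = _
    rw [hL, map_one, Module.End.one_apply]

end ProjectiveCoordinates

end OperSCL

theorem mainTheorem9 {C ι : Type*} [TopologicalSpace C] [ChartedSpace ℂ C]
    [IsManifold 𝓘(ℂ, ℂ) ω C] [T2Space C] [CompactSpace C] [ConnectedSpace C]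
    (hgenus : 2 ≤ genus C) (P : ProjectiveCoordinates C ι) (q : quadraticDifferentials C) :
    -- the global ħ-connection is `ħ d - φ_α(q) dz_α` in every projective coordinate
    (∀ (ħ : ℂ) (U : Opens C), ∀ s ∈ holSections (P.E ħ) U, ∀ α, ∀ x ∈ U ⊓ P.dom α, ∀ i : Fin 2,
      comp (P.E ħ) α (fun y => P.hbarConn q ħ (ext0 s) y (coordVec (P.chart α) y)) x i
        = ħ * dz (P.chart α) (fun y => comp (P.E ħ) α (ext0 s) y i) x
          - (P.higgsMatrix q α x).mulVec (comp (P.E ħ) α (ext0 s) x) i) ∧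
    -- the D-module of the ħ-connection is locally the D-module of the quantum curve, generated by
    -- the local frame of the subbundle `K^{1/2}`
    (∀ ħ : ℂ, ħ ≠ 0 → ∀ (α : ι) (U : Opens C) (hU : U ≤ P.dom α),
      (∃! ρ, P.IsDModuleAction q ħ hU ρ) ∧
      ∀ ρ, P.IsDModuleAction q ħ hU ρ →
        ∃ Φ : P.QuantumModule q ħ hU ≃+ holSections (P.E ħ) U,
          (∀ T y, Φ (T • y) = ρ T (Φ y)) ∧
          ∀ x ∈ U, comp (P.E ħ) α (ext0 (Φ (Submodule.Quotient.mk 1)).1) x = ![1, 0]) ∧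
    -- the quantum curve is globally defined on `K^{-1/2}`, with values in `K^{3/2}`
    (∀ (ħ : ℂ) (U : Opens C), ∀ ψ ∈ holSections P.invHalf U, ∀ α β,
      ∀ x ∈ U ⊓ (P.dom α ⊓ P.dom β),
        P.quantumOp q ħ α (comp P.invHalf α (ext0 ψ)) x
          = P.ξ α β x ^ 3 * P.quantumOp q ħ β (comp P.invHalf β (ext0 ψ)) x) ∧
    -- flat sections `(ħ ψ', ψ)` correspond to solutions `ψ` of `ħ² ψ'' - q ψ = 0`
    (∀ ħ : ℂ, ħ ≠ 0 → ∀ U : Opens C,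
      Set.BijOn (fun Ψ (x : U) => P.proj (Ψ x)) (P.flatSections q ħ U)
        (P.quantumSolutions q ħ U) ∧
      ∀ Ψ ∈ P.flatSections q ħ U, ∀ α, ∀ x ∈ U ⊓ P.dom α,
        comp (P.E ħ) α (ext0 Ψ) x =
          ![ħ * dz (P.chart α)
                (comp P.invHalf α (ext0 (fun y : U => P.proj (Ψ y)))) x,
            comp P.invHalf α (ext0 (fun y : U => P.proj (Ψ y))) x]) ∧
    -- the conjugated ħ-connections have the limit `η - φ(q)` at every point of `T*C`
    (∀ p : Cotangent C,
      IsSemiclassicalLimitAt P.E (P.hbarConn q) p.1 p.2 (tautMinus (P.higgs q) p.1 p.2)) ∧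
    -- the semi-classical limit is the Hitchin spectral curve
    semiclassicalLimit P.E (P.hbarConn q) = spectralCurve (P.higgs q) ∧
    -- `det (η - φ(q)) = η² - q`, which is `y² - q = 0` in a projective coordinate
    (∀ (p : Cotangent C) (v : TangentSpace 𝓘(ℂ, ℂ) p.1),
      LinearMap.det (tautMinus (P.higgs q) p.1 p.2 v) = p.2 v ^ 2 - q.1 p.1 v v) ∧
    (∀ (α : ι) (p : Cotangent C), p.1 ∈ P.dom α →
      (p ∈ spectralCurve (P.higgs q) ↔
        p.2 (coordVec (P.chart α) p.1) ^ 2 - coeff q (P.chart α) p.1 = 0)) ∧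
    -- the semi-classical limit of the quantum curve operator is `y² - q`
    (∀ (α : ι), ∀ x ∈ P.dom α, ∀ S u : C → ℂ,
      ContMDiffAt 𝓘(ℂ, ℂ) 𝓘(ℂ, ℂ) ω S x → ContMDiffAt 𝓘(ℂ, ℂ) 𝓘(ℂ, ℂ) ω u x →
      Filter.Tendsto
        (fun ħ : ℂ => Complex.exp (-(S x / ħ)) *
          P.quantumOp q ħ α (fun y => Complex.exp (S y / ħ) * u y) x)
        (𝓝[≠] 0)
        (𝓝 ((dz (P.chart α) S x ^ 2 - coeff q (P.chart α) x) * u x))) := by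
  refine ⟨fun ħ U s hs α x hx i => ?_, fun ħ hħ α U hU => ⟨?_, fun ρ hρ => ?_⟩,
    fun ħ U ψ hψ α β x hx => ?_, fun ħ hħ U => ⟨P.bijOn_proj hħ q U, fun Ψ hΨ α x hx => ?_⟩,
    fun p => P.isSemiclassicalLimitAt_tautMinus q p.2, P.semiclassicalLimit_eq_spectralCurve q,
    fun p v => P.det_tautMinus q p.2 v, fun α p hp => P.mem_spectralCurve_iff q p hp,
    fun α x hx S u hS hu => P.tendsto_quantumOp q hx hS hu⟩
  · rw [P.hbarConn_coordVec q hx.2 (mdifferentiableAt_comp _ hs hx.1 hx.2), higgsMatrix_mulVec]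
    fin_cases i <;> rfl
  · exact ⟨_, P.isDModuleAction_sectionAction hħ q hU, fun ρ hρ =>
      hρ.eq P hħ (P.isDModuleAction_sectionAction hħ q hU)⟩
  · obtain rfl := hρ.eq P hħ (P.isDModuleAction_sectionAction hħ q hU)
    obtain ⟨Φ, hΦ, h1⟩ := P.exists_quantumModule_equiv hħ q hU
    refine ⟨Φ, hΦ, fun x hx => ?_⟩
    rw [h1, P.comp_frameSection hU _ hx, ext0_of_mem _ hx, ext0_of_mem _ hx]
    rfl
  · exact P.quantumOp_comp_invHalf_change q hx.2.1 hx.2.2 (contMDiffAt_comp _ hψ hx.1 hx.2.2)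
  · exact P.comp_ext0_eq_of_mem_flatSections hΨ hx.1 hx.2
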